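/- **Truncated approximation: error bound.** Let $\mathbb F=\mathbb R$ or $\mathbb F=\mathbb C$, and put $\alpha=1$ if $\mathbb F=\mathbb R$, $\alpha=0$ if $\mathbb F=\mathbb C$. Let $A\in\mathbb F^{m\times n}$ be an arbitrary matrix, and let $k,s$ be natural numbers with $\alpha<k\le\min\{m,n\}$ and $s\ge 2k+\alpha$. Let $\Upsilon\in\mathbb F^{k\times m}$, $\Omega\in\mathbb F^{k\times n}$, $\Phi\in\mathbb F^{s\times m}$, $\Psi\in\mathbb F^{s\times n}$ be independent random matrices, each with independent standard normal entries (a complex standard normal variable is $g_1+\mathrm i g_2$ with $g_1,g_2$ independent real standard normal variables). Form the sketch $$X=\Upsilon A,\qquad Y=A\Omega^*,\qquad Z=\Phi A\Psi^* .$$ Compute thin QR factorizations $X^*=PR_1$ and $Y=QR_2$, where $P\in\mathbb F^{n\times k}$ and $Q\in\mathbb F^{m\times k}$ have orthonormal columns and $R_1,R_2$ are upper triangular; here $P$ is obtained from $X^*$, and $Q$ from $Y$, by an arbitrary fixed (measurable) QR routine. Put $$C=(\Phi Q)^\dagger Z\,((\Psi P)^\dagger)^*\in\mathbb F^{k\times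 k},\qquad \hat A=QCP^*,$$ where ${}^\dagger$ is the Moore–Penrose pseudoinverse. For a matrix $M$ and an integer $r\ge 0$ let $[M]_r$ denote any best approximation of $M$ in Frobenius norm among the matrices of rank at most $r$, and let $$\tau_{r+1}^2(M)=\min_{\operatorname{rank}B\le r}\|M-B\|_F^2,\qquad \tau_{r+1}(M)\ge 0 .$$ Then, for every integer $r\ge 0$, the rank-$r$ truncations of $\hat A$ are exactly the matrices $[\hat A]_r=Q[C]_rP^*$, and, for every random matrix $[\hat A]_r$ that is almost surely such a truncation, $\|A-[\hat A]_r\|_F$ is integrable and $$\mathbb E\,\|A-[\hat A]_r\|_F\;\le\;\tau_{r+1}(A)+2\left[\frac{s-\alpha}{s-k-\alpha}\cdot\min_{0\le\varrho<k-\alpha}\frac{k+\varrho-\alpha}{k-\varrho-\alpha}\cdot\tau_{\varrho+1}^2(A)\right]^{1/2},$$ where $\varrho$ runs over the integers. -/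

import Mathlib

open MeasureTheory ProbabilityTheory
open scoped Matrix Matrix.Norms.Frobenius

noncomputable section

/-- Matrices carry the product sigma-algebra of their entries. -/
instance matrixMeasurableSpace {I J R : Type*} [MeasurableSpace R] :
    MeasurableSpace (Matrix I J R) :=
  inferInstanceAs (MeasurableSpace (I → J → R))

/-! ### The scalar field and Gaussian matrices -/

open Classical in
/-- The field parameter `α(𝕜)`: it is `1` if `𝕜` is the real field (where `RCLike.I = 0`)
and `0` if `𝕜` is the complex field. -/
def fieldAlpha (𝕜 : Type*) [RCLike 𝕜] : ℕ :=
  if (RCLike.I : 𝕜) = 0 then 1 else 0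

/-- The standard normal law on `𝕜`: the law of `g₁ + i g₂` with `g₁, g₂` independent real standard
normal variables. For the real field `RCLike.I = 0`, so that this is the law of `g₁`. -/
def stdNormal (𝕜 : Type*) [RCLike 𝕜] [MeasurableSpace 𝕜] : Measure 𝕜 :=
  ((gaussianReal 0 1).prod (gaussianReal 0 1)).map
    (fun g : ℝ × ℝ => (g.1 : 𝕜) + (g.2 : 𝕜) * RCLike.I)

/-- The law of a `d × N` random matrix with independent standard normal entries. -/
def gaussianMatrix (𝕜 : Type*) [RCLike 𝕜] [MeasurableSpace 𝕜] (d N : ℕ) :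
    Measure (Matrix (Fin d) (Fin N) 𝕜) :=
  Measure.pi fun _ : Fin d => Measure.pi fun _ : Fin N => stdNormal 𝕜

/-! ### Best low-rank approximation -/

section LowRank

variable {𝕜 : Type*} [RCLike 𝕜] {m n : ℕ}

/-- The tail energy `τ_j(A)` for `j ≥ 1`, where
`τ_{r+1}(A)² = min { ‖A - B‖_F² : rank B ≤ r }`. -/
def tailEnergy (j : ℕ) (A : Matrix (Fin m) (Fin n) 𝕜) : ℝ :=
  √(sInf ((fun B : Matrix (Fin m) (Fin n) 𝕜 => ‖A - B‖ ^ 2) '' {B | B.rank < j}))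

/-- `B` is a best rank-`r` approximation of `M` in Frobenius norm, that is, an admissible value
of `[M]_r`. -/
def IsBestRankApprox (r : ℕ) (M B : Matrix (Fin m) (Fin n) 𝕜) : Prop :=
  B.rank ≤ r ∧ ∀ B' : Matrix (Fin m) (Fin n) 𝕜, B'.rank ≤ r → ‖M - B‖ ≤ ‖M - B'‖

end LowRank

/-! ### The Moore-Penrose pseudoinverse -/

section Pseudoinverse

variable {𝕜 : Type*} [RCLike 𝕜] {p q : ℕ}

/-- The four Penrose equations. -/
structure IsMoorePenrose (M : Matrix (Fin p) (Fin q) 𝕜) (N : Matrix (Fin q) (Fin p) 𝕜) :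
    Prop where
  mul_mul_self : M * N * M = M
  self_mul_mul : N * M * N = N
  left_hermitian : (M * N)ᴴ = M * N
  right_hermitian : (N * M)ᴴ = N * M

open scoped ComplexOrder in
theorem exists_isMoorePenrose (M : Matrix (Fin p) (Fin q) 𝕜) :
    ∃ N : Matrix (Fin q) (Fin p) 𝕜, IsMoorePenrose M N := by
  have hH : (Mᴴ * M).IsHermitian := Matrix.isHermitian_conjTranspose_mul_self M
  obtain ⟨G, hG, hGH, hHGH, hGHG⟩ : ∃ G : Matrix (Fin q) (Fin q) 𝕜, Gᴴ = G ∧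
      (G * (Mᴴ * M))ᴴ = G * (Mᴴ * M) ∧
      (Mᴴ * M) * G * (Mᴴ * M) = Mᴴ * M ∧ G * (Mᴴ * M) * G = G := by
    set U : Matrix (Fin q) (Fin q) 𝕜 := hH.eigenvectorUnitary.1 with hU
    have hUU : Uᴴ * U = 1 := by
      simpa [hU, Matrix.star_eq_conjTranspose] using
        (Matrix.mem_unitaryGroup_iff'.1 hH.eigenvectorUnitary.2)
    set d : Fin q → 𝕜 := fun i => (hH.eigenvalues i : 𝕜) with hd
    set e : Fin q → 𝕜 := fun i => ((hH.eigenvalues i)⁻¹ : ℝ) with he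
    have hspec : Mᴴ * M = U * Matrix.diagonal d * Uᴴ := by
      have h := hH.spectral_theorem
      rw [Unitary.conjStarAlgAut_apply] at h
      exact h
    have hmul : ∀ a b : Fin q → 𝕜, (U * Matrix.diagonal a * Uᴴ) * (U * Matrix.diagonal b * Uᴴ)
        = U * Matrix.diagonal (fun i => a i * b i) * Uᴴ := by
      intro a b
      calc _ = U * Matrix.diagonal a * (Uᴴ * U) * Matrix.diagonal b * Uᴴ := by
            simp only [Matrix.mul_assoc]
        _ = _ := by
            rw [hUU, Matrix.mul_one, Matrix.mul_assoc U, Matrix.diagonal_mul_diagonal]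
    have hstar : ∀ a : Fin q → ℝ, (U * Matrix.diagonal (fun i => (a i : 𝕜)) * Uᴴ)ᴴ
        = U * Matrix.diagonal (fun i => (a i : 𝕜)) * Uᴴ := by
      intro a
      rw [Matrix.conjTranspose_mul, Matrix.conjTranspose_mul, Matrix.conjTranspose_conjTranspose,
        Matrix.diagonal_conjTranspose, Matrix.mul_assoc]
      congr 3
      ext i
      simp
    refine ⟨U * Matrix.diagonal e * Uᴴ, hstar _, ?_, ?_, ?_⟩
    · rw [hspec, hmul]
      have : (fun i => e i * d i) =
          fun i => (((hH.eigenvalues i)⁻¹ * hH.eigenvalues i : ℝ) : 𝕜) := by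
        ext i; simp [hd, he]
      rw [this, hstar]
    · rw [hspec, hmul, hmul]
      congr 3
      ext i
      by_cases h : hH.eigenvalues i = 0 <;> simp [hd, he, h]
    · rw [hspec, hmul, hmul]
      congr 3
      ext i
      by_cases h : hH.eigenvalues i = 0 <;> simp [hd, he, h]
  refine ⟨G * Mᴴ, ?_, ?_, ?_, ?_⟩
  · have h0 : M * (G * (Mᴴ * M) - 1) = 0 := by
      rw [← Matrix.conjTranspose_mul_self_eq_zero, Matrix.conjTranspose_mul, Matrix.mul_assoc,
        ← Matrix.mul_assoc Mᴴ, Matrix.mul_sub, ← Matrix.mul_assoc _ G, hHGH]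
      simp
    rw [Matrix.mul_sub, Matrix.mul_one, sub_eq_zero] at h0
    simpa only [Matrix.mul_assoc] using h0
  · calc G * Mᴴ * M * (G * Mᴴ) = (G * (Mᴴ * M) * G) * Mᴴ := by simp only [Matrix.mul_assoc]
      _ = G * Mᴴ := by rw [hGHG]
  · simp only [Matrix.conjTranspose_mul, Matrix.conjTranspose_conjTranspose, hG, Matrix.mul_assoc]
  · rw [Matrix.mul_assoc]
    exact hGH

/-- The Moore-Penrose pseudoinverse `M†`: the matrix that satisfies the four Penrose equations. -/
def pinv (M : Matrix (Fin p) (Fin q) 𝕜) : Matrix (Fin q) (Fin p) 𝕜 :=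
  Classical.choose (exists_isMoorePenrose M)

theorem pinv_spec (M : Matrix (Fin p) (Fin q) 𝕜) : IsMoorePenrose M (pinv M) :=
  Classical.choose_spec (exists_isMoorePenrose M)

end Pseudoinverse

/-! ### The sketching algorithm -/

section Sketch

variable {𝕜 : Type*} [RCLike 𝕜] {m n k s : ℕ}

/-- A (measurable) routine that returns the orthonormal factor of a thin QR factorization of each
`N × k` matrix. The factorization is not unique, in particular for rank-deficient matrices; every
choice is allowed. Such a routine exists only if `k ≤ N`. -/
structure IsThinQR [MeasurableSpace 𝕜] {N k : ℕ}
    (qr : Matrix (Fin N) (Fin k) 𝕜 → Matrix (Fin N) (Fin k) 𝕜) : Prop where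
  measurable : Measurable qr
  orthonormal : ∀ M, (qr M)ᴴ * qr M = 1
  factor : ∀ M, ∃ R : Matrix (Fin k) (Fin k) 𝕜, R.BlockTriangular id ∧ M = qr M * R

/-- The co-range sketch `X = Υ A`. -/
def corangeSketch (Υ : Matrix (Fin k) (Fin m) 𝕜) (A : Matrix (Fin m) (Fin n) 𝕜) :
    Matrix (Fin k) (Fin n) 𝕜 := Υ * A

/-- The range sketch `Y = A Ω*`. -/
def rangeSketch (A : Matrix (Fin m) (Fin n) 𝕜) (Ω : Matrix (Fin k) (Fin n) 𝕜) :
    Matrix (Fin m) (Fin k) 𝕜 := A * Ωᴴ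

/-- The core sketch `Z = Φ A Ψ*`. -/
def coreSketch (Φ : Matrix (Fin s) (Fin m) 𝕜) (A : Matrix (Fin m) (Fin n) 𝕜)
    (Ψ : Matrix (Fin s) (Fin n) 𝕜) : Matrix (Fin s) (Fin s) 𝕜 := Φ * A * Ψᴴ

/-- The core approximation `C = (ΦQ)† Z ((ΨP)†)*`. -/
def coreApprox (Φ : Matrix (Fin s) (Fin m) 𝕜) (Ψ : Matrix (Fin s) (Fin n) 𝕜)
    (Z : Matrix (Fin s) (Fin s) 𝕜) (Q : Matrix (Fin m) (Fin k) 𝕜) (P : Matrix (Fin n) (Fin k) 𝕜) :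
    Matrix (Fin k) (Fin k) 𝕜 := pinv (Φ * Q) * Z * (pinv (Ψ * P))ᴴ

/-- The initial approximation `Â = Q C P*`. -/
def initialApprox (Q : Matrix (Fin m) (Fin k) 𝕜) (C : Matrix (Fin k) (Fin k) 𝕜)
    (P : Matrix (Fin n) (Fin k) 𝕜) : Matrix (Fin m) (Fin n) 𝕜 := Q * C * Pᴴ

/-- The right-hand side of the error bound for the initial approximation,
`(s - α)/(s - k - α) · min_{ϱ < k - α} (k + ϱ - α)/(k - ϱ - α) · τ_{ϱ+1}(A)²`.
The index `ϱ` runs over the naturals with `ϱ < k - α`, a finite set that is nonempty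
if `α < k`. -/
def initialErrorBound (k s : ℕ) (A : Matrix (Fin m) (Fin n) 𝕜) : ℝ :=
  ((s : ℝ) - fieldAlpha 𝕜) / ((s : ℝ) - k - fieldAlpha 𝕜) *
    ⨅ ϱ : Fin (k - fieldAlpha 𝕜),
      ((k : ℝ) + (ϱ : ℕ) - fieldAlpha 𝕜) / ((k : ℝ) - (ϱ : ℕ) - fieldAlpha 𝕜) *
        tailEnergy ((ϱ : ℕ) + 1) A ^ 2

end Sketch

end

/-! ### Frobenius geometry, orthogonal projections and reflections -/

section Frobenius

variable {𝕜 : Type*} [RCLike 𝕜] {I J K : Type*} [Fintype I] [Fintype J] [Fintype K]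

/-! Truncation is handled deterministically. If T is a best rank-r approximation of Â and B any
matrix of rank at most r, then ‖A - T‖ ≤ ‖A - Â‖ + ‖Â - B‖ ≤ 2‖A - Â‖ + ‖A - B‖; minimizing over B
gives `norm_sub_isBestRankApprox_le`. So E‖A - Â‖² has to be bounded, and
`integral_le_of_lintegral_sq_le` passes to the first moment. The formula for the truncations is
Pythagoras for the compression by Q and P (`isBestRankApprox_compress_iff`).

The second moment factors into two stages. With Q and P frozen, A - Â is the orthogonal sum of A -
QQ*APP* and Q(Q*AP - C)P*. Almost surely (ΦQ)†Φ = Q* + E and (ΨP)†Ψ = P* + F with E, F supported off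
the ranges of Q and P, so C - Q*AP = EAP + Q*AF* + EAF*. Reflecting Φ or Ψ in the range of Q or P
preserves the Gaussian law and flips the sign of E or F, which removes cross terms. Since ΦQ is
independent of Φ(1 - QQ*), E‖EM‖² ≤ c‖(1 - QQ*)M‖² with c = k/(s - k - α), by the inverse moment of
a Gaussian matrix (`lintegral_norm_leftInv_sq_le`). As c ≤ 1, the total is at most (1 + c)‖A -
QQ*APP*‖², the first factor of the bound (`lintegral_norm_sub_leftInvCore_sq_le`).

The second stage bounds E‖A - QQ*APP*‖² for each ϱ < k - α (`lintegral_norm_sub_compress_sq_le`).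
One-sided range-finder estimates cost ϱ/(k - ϱ - α)·τ² each, but adding two full one-sided errors
would count the tail τ² twice. Averaging over the reflection of Ω in the leading right singular
space avoids this (`norm_sq_reflection_average_le`) and leaves 1 + 2ϱ/(k - ϱ - α) = (k + ϱ - α)/(k -
ϱ - α). -/

theorem frobenius_norm_sq (M : Matrix I J 𝕜) : ‖M‖ ^ 2 = ∑ i, ∑ j, ‖M i j‖ ^ 2 := by
  rw [Matrix.frobenius_norm_def, ← Real.sqrt_eq_rpow, Real.sq_sqrt (by positivity)]
  simp

theorem frobenius_norm_sq_eq_trace (M : Matrix I J 𝕜) : ‖M‖ ^ 2 = RCLike.re (Mᴴ * M).trace := by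
  rw [frobenius_norm_sq, Finset.sum_comm]
  simp only [Matrix.trace, Matrix.diag, Matrix.mul_apply, map_sum, Matrix.conjTranspose_apply]
  refine Finset.sum_congr rfl fun j _ => Finset.sum_congr rfl fun i _ => ?_
  rw [RCLike.star_def, RCLike.conj_mul]
  norm_cast

theorem frobenius_norm_sq_add (M N : Matrix I J 𝕜) :
    ‖M + N‖ ^ 2 = ‖M‖ ^ 2 + 2 * RCLike.re (Mᴴ * N).trace + ‖N‖ ^ 2 := by
  have h : RCLike.re (Nᴴ * M).trace = RCLike.re (Mᴴ * N).trace := by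
    have : Nᴴ * M = (Mᴴ * N)ᴴ := by simp
    rw [this, Matrix.trace_conjTranspose]
    simp
  simp only [frobenius_norm_sq_eq_trace, Matrix.conjTranspose_add, Matrix.add_mul, Matrix.mul_add,
    Matrix.trace_add, map_add, h]
  ring

/-- Averaging over a sign removes the cross term; both reflection arguments rest on this identity.
-/
theorem frobenius_parallelogram (M N : Matrix I J 𝕜) :
    ‖M + N‖ ^ 2 + ‖M - N‖ ^ 2 = 2 * (‖M‖ ^ 2 + ‖N‖ ^ 2) := by
  rw [sub_eq_add_neg, frobenius_norm_sq_add, frobenius_norm_sq_add, norm_neg, Matrix.mul_neg,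
    Matrix.trace_neg, map_neg]
  ring

theorem frobenius_pythagoras_left {M N : Matrix I J 𝕜} (h : Mᴴ * N = 0) :
    ‖M + N‖ ^ 2 = ‖M‖ ^ 2 + ‖N‖ ^ 2 := by
  rw [frobenius_norm_sq_add, h]
  simp

theorem frobenius_pythagoras_right {M N : Matrix I J 𝕜} (h : M * Nᴴ = 0) :
    ‖M + N‖ ^ 2 = ‖M‖ ^ 2 + ‖N‖ ^ 2 := by
  have h' : Mᴴᴴ * Nᴴ = 0 := by simpa using h
  simpa only [← Matrix.conjTranspose_add, Matrix.frobenius_norm_conjTranspose] using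
    frobenius_pythagoras_left h'

theorem frobenius_norm_isometry_mul [DecidableEq J] {V : Matrix I J 𝕜} (hV : Vᴴ * V = 1)
    (M : Matrix J K 𝕜) : ‖V * M‖ = ‖M‖ := by
  have : ‖V * M‖ ^ 2 = ‖M‖ ^ 2 := by
    rw [frobenius_norm_sq_eq_trace, frobenius_norm_sq_eq_trace, Matrix.conjTranspose_mul,
      Matrix.mul_assoc, ← Matrix.mul_assoc Vᴴ, hV, Matrix.one_mul]
  exact (pow_left_inj₀ (norm_nonneg _) (norm_nonneg _) two_ne_zero).1 this

theorem frobenius_norm_mul_isometry [DecidableEq J] {V : Matrix I J 𝕜} (hV : Vᴴ * V = 1)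
    (M : Matrix K J 𝕜) : ‖M * Vᴴ‖ = ‖M‖ := by
  rw [← Matrix.frobenius_norm_conjTranspose (M * Vᴴ), Matrix.conjTranspose_mul,
    Matrix.conjTranspose_conjTranspose, frobenius_norm_isometry_mul hV,
    Matrix.frobenius_norm_conjTranspose]

/-- Orthogonal projections: Hermitian idempotent matrices. -/
structure IsOrthProj (P : Matrix I I 𝕜) : Prop where
  hermitian : Pᴴ = P
  idem : P * P = P

namespace IsOrthProj

variable {P : Matrix I I 𝕜} [DecidableEq I]

theorem compl (h : IsOrthProj P) : IsOrthProj (1 - P) :=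
  ⟨by simp [h.hermitian], by simp [Matrix.mul_sub, Matrix.sub_mul, h.idem]⟩

theorem mul_compl (h : IsOrthProj P) : P * (1 - P) = 0 := by
  simp [Matrix.mul_sub, h.idem]

theorem compl_mul (h : IsOrthProj P) : (1 - P) * P = 0 := by
  simp [Matrix.sub_mul, h.idem]

theorem norm_sq_left (h : IsOrthProj P) (M : Matrix I J 𝕜) :
    ‖M‖ ^ 2 = ‖P * M‖ ^ 2 + ‖(1 - P) * M‖ ^ 2 := by
  rw [← frobenius_pythagoras_left, ← Matrix.add_mul, add_sub_cancel, Matrix.one_mul]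
  rw [Matrix.conjTranspose_mul, h.hermitian, Matrix.mul_assoc, ← Matrix.mul_assoc P, h.mul_compl]
  simp

theorem norm_sq_right (h : IsOrthProj P) (M : Matrix J I 𝕜) :
    ‖M‖ ^ 2 = ‖M * P‖ ^ 2 + ‖M * (1 - P)‖ ^ 2 := by
  rw [← frobenius_pythagoras_right, ← Matrix.mul_add, add_sub_cancel, Matrix.mul_one]
  rw [Matrix.conjTranspose_mul, h.compl.hermitian, Matrix.mul_assoc, ← Matrix.mul_assoc P,
    h.mul_compl]
  simp

theorem norm_mul_le (h : IsOrthProj P) (M : Matrix I J 𝕜) : ‖P * M‖ ≤ ‖M‖ := by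
  have := h.norm_sq_left M
  exact (pow_le_pow_iff_left₀ (norm_nonneg _) (norm_nonneg _) two_ne_zero).1 (by nlinarith [sq_nonneg ‖(1 - P) * M‖])

theorem norm_mul_le' (h : IsOrthProj P) (M : Matrix J I 𝕜) : ‖M * P‖ ≤ ‖M‖ := by
  have := h.norm_sq_right M
  exact (pow_le_pow_iff_left₀ (norm_nonneg _) (norm_nonneg _) two_ne_zero).1 (by nlinarith [sq_nonneg ‖M * (1 - P)‖])

/-- The reflection `1 - 2P` is an involution. -/
theorem reflection_mul_self (h : IsOrthProj P) :
    (1 - (2 : 𝕜) • P) * (1 - (2 : 𝕜) • P) = 1 := by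
  simp only [Matrix.mul_sub, Matrix.sub_mul, Matrix.mul_one, Matrix.one_mul, Matrix.mul_smul,
    Matrix.smul_mul, h.idem]
  module

theorem reflection_hermitian (h : IsOrthProj P) :
    (1 - (2 : 𝕜) • P)ᴴ = 1 - (2 : 𝕜) • P := by
  simp [h.hermitian, Matrix.conjTranspose_smul]

end IsOrthProj

theorem IsOrthProj.of_isometry [DecidableEq J] {V : Matrix I J 𝕜} (hV : Vᴴ * V = 1) : IsOrthProj (V * Vᴴ) :=
  ⟨by simp, by rw [Matrix.mul_assoc, ← Matrix.mul_assoc Vᴴ, hV, Matrix.one_mul]⟩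

theorem isOrthProj_mul_pinv {p q : ℕ} (Y : Matrix (Fin p) (Fin q) 𝕜) :
    IsOrthProj (Y * pinv Y) :=
  ⟨(pinv_spec Y).left_hermitian, by
    rw [← Matrix.mul_assoc, (pinv_spec Y).mul_mul_self]⟩

/-- If `MᴴM` is invertible, then the pseudoinverse is `(MᴴM)⁻¹Mᴴ`. -/
theorem pinv_eq_of_isUnit_det {p q : ℕ} {M : Matrix (Fin p) (Fin q) 𝕜}
    (h : IsUnit (Mᴴ * M).det) : pinv M = (Mᴴ * M)⁻¹ * Mᴴ := by
  have hp := pinv_spec M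
  have h1 : Mᴴ * M * pinv M = Mᴴ := by
    rw [Matrix.mul_assoc, ← hp.left_hermitian, ← Matrix.conjTranspose_mul, hp.mul_mul_self]
  rw [← congrArg ((Mᴴ * M)⁻¹ * ·) h1, Matrix.nonsing_inv_mul_cancel_left _ _ h]

end Frobenius

/-! ### Compression by orthonormal bases and rank truncation -/

section Truncation

variable {𝕜 : Type*} [RCLike 𝕜] {m n k : ℕ}

theorem rank_mul_mul_le {a b c d : ℕ} (X : Matrix (Fin a) (Fin b) 𝕜) (Y : Matrix (Fin b) (Fin c) 𝕜)
    (Z : Matrix (Fin c) (Fin d) 𝕜) : (X * Y * Z).rank ≤ Y.rank :=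
  (Matrix.rank_mul_le_left _ _).trans (Matrix.rank_mul_le_right _ _)

/-- Distance to a matrix with column space in `range Q` and row space in `range P`. -/
theorem norm_sq_compress_sub {Q : Matrix (Fin m) (Fin k) 𝕜} {P : Matrix (Fin n) (Fin k) 𝕜}
    (hQ : Qᴴ * Q = 1) (hP : Pᴴ * P = 1) (C : Matrix (Fin k) (Fin k) 𝕜)
    (B : Matrix (Fin m) (Fin n) 𝕜) :
    ‖Q * C * Pᴴ - B‖ ^ 2 = ‖C - Qᴴ * B * P‖ ^ 2 + ‖B - Q * (Qᴴ * B * P) * Pᴴ‖ ^ 2 := by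
  have h1 : Q * C * Pᴴ - B = Q * (C - Qᴴ * B * P) * Pᴴ + (Q * (Qᴴ * B * P) * Pᴴ - B) := by
    simp only [Matrix.mul_sub, Matrix.sub_mul]
    abel
  have h2 : Qᴴ * (Q * (Qᴴ * B * P) * Pᴴ - B) * P = 0 := by
    have : Qᴴ * (Q * (Qᴴ * B * P) * Pᴴ) * P = (Qᴴ * Q) * (Qᴴ * B * P) * (Pᴴ * P) := by
      simp only [Matrix.mul_assoc]
    rw [Matrix.mul_sub, Matrix.sub_mul, this, hQ, hP]
    simp
  have h3 : ((Q * (C - Qᴴ * B * P) * Pᴴ)ᴴ * (Q * (Qᴴ * B * P) * Pᴴ - B)).trace = 0 := by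
    rw [Matrix.conjTranspose_mul, Matrix.conjTranspose_mul, Matrix.conjTranspose_conjTranspose,
      Matrix.trace_mul_comm, ← Matrix.mul_assoc, ← Matrix.mul_assoc, Matrix.trace_mul_comm,
      ← Matrix.mul_assoc, ← Matrix.mul_assoc, h2]
    simp
  rw [h1, frobenius_norm_sq_add, h3, frobenius_norm_mul_isometry hP, frobenius_norm_isometry_mul hQ,
    ← norm_neg (Q * (Qᴴ * B * P) * Pᴴ - B), neg_sub]
  simp

theorem norm_compress_sub_compress {Q : Matrix (Fin m) (Fin k) 𝕜} {P : Matrix (Fin n) (Fin k) 𝕜}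
    (hQ : Qᴴ * Q = 1) (hP : Pᴴ * P = 1) (C D : Matrix (Fin k) (Fin k) 𝕜) :
    ‖Q * C * Pᴴ - Q * D * Pᴴ‖ = ‖C - D‖ := by
  rw [← Matrix.sub_mul, ← Matrix.mul_sub, frobenius_norm_mul_isometry hP,
    frobenius_norm_isometry_mul hQ]

/-- Replacing B by its compression QQ*BPP* does not raise the rank, and by Pythagoras it lowers the
distance to QCP* strictly unless B is already compressed. Compressed matrices correspond
isometrically to k × k cores. -/
theorem isBestRankApprox_compress_iff {Q : Matrix (Fin m) (Fin k) 𝕜} {P : Matrix (Fin n) (Fin k) 𝕜}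
    (hQ : Qᴴ * Q = 1) (hP : Pᴴ * P = 1) (r : ℕ) (C : Matrix (Fin k) (Fin k) 𝕜)
    (B : Matrix (Fin m) (Fin n) 𝕜) :
    IsBestRankApprox r (Q * C * Pᴴ) B ↔
      ∃ Cr, IsBestRankApprox r C Cr ∧ B = Q * Cr * Pᴴ := by
  have key : ∀ B : Matrix (Fin m) (Fin n) 𝕜, ‖C - Qᴴ * B * P‖ ≤ ‖Q * C * Pᴴ - B‖ := fun B => by
    refine (pow_le_pow_iff_left₀ (norm_nonneg _) (norm_nonneg _) two_ne_zero).1 ?_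
    rw [norm_sq_compress_sub hQ hP C B]
    exact le_add_of_nonneg_right (by positivity)
  constructor
  · rintro ⟨hr, hB⟩
    have hr' : (Qᴴ * B * P).rank ≤ r := (rank_mul_mul_le _ _ _).trans hr
    have h1 := hB (Q * (Qᴴ * B * P) * Pᴴ) ((rank_mul_mul_le _ _ _).trans hr')
    rw [norm_compress_sub_compress hQ hP] at h1
    have h2 := norm_sq_compress_sub hQ hP C B
    have h3 : ‖B - Q * (Qᴴ * B * P) * Pᴴ‖ = 0 := by
      have := pow_le_pow_left₀ (norm_nonneg _) h1 2
      exact pow_eq_zero_iff two_ne_zero |>.1 (le_antisymm (by linarith) (by positivity))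
    refine ⟨Qᴴ * B * P, ⟨hr', fun C' hC' => (key B).trans ?_⟩, sub_eq_zero.1 (norm_eq_zero.1 h3)⟩
    rw [← norm_compress_sub_compress hQ hP C C']
    exact hB _ ((rank_mul_mul_le _ _ _).trans hC')
  · rintro ⟨Cr, ⟨hr, hC⟩, rfl⟩
    refine ⟨(rank_mul_mul_le _ _ _).trans hr, fun B' hB' => ?_⟩
    rw [norm_compress_sub_compress hQ hP]
    exact (hC _ ((rank_mul_mul_le _ _ _).trans hB')).trans (key B')

theorem le_tailEnergy {A : Matrix (Fin m) (Fin n) 𝕜} {r : ℕ} {c : ℝ}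
    (h : ∀ B : Matrix (Fin m) (Fin n) 𝕜, B.rank ≤ r → c ≤ ‖A - B‖) : c ≤ tailEnergy (r + 1) A := by
  rcases le_or_gt c 0 with hc | hc
  · exact hc.trans (Real.sqrt_nonneg _)
  -- The zero matrix, of rank 0 < r + 1, makes the set nonempty, so that its infimum is not the
  -- default value.
  refine Real.le_sqrt_of_sq_le (le_csInf ⟨_, 0, by simp, rfl⟩ ?_)
  rintro _ ⟨B, hB, rfl⟩
  exact pow_le_pow_left₀ hc.le (h B (Nat.lt_succ_iff.1 hB)) 2

/-- Truncating an approximation `M` of `A` costs at most twice the error of `M`. -/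
theorem norm_sub_isBestRankApprox_le {A M T : Matrix (Fin m) (Fin n) 𝕜} {r : ℕ}
    (hT : IsBestRankApprox r M T) : ‖A - T‖ ≤ tailEnergy (r + 1) A + 2 * ‖A - M‖ := by
  rw [← sub_le_iff_le_add]
  refine le_tailEnergy fun B hB => ?_
  have h1 := norm_sub_le_norm_sub_add_norm_sub A M T
  have h2 := norm_sub_le_norm_sub_add_norm_sub M A B
  rw [norm_sub_rev M A] at h2
  linarith [hT.2 B hB]

end Truncation

/-! ### Gaussian laws through characteristic functions -/

section GaussianLaw

variable {𝕜 : Type*} [RCLike 𝕜] [MeasurableSpace 𝕜] [BorelSpace 𝕜]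

variable (𝕜) in
theorem measurable_stdNormal_map :
    Measurable (fun g : ℝ × ℝ => (g.1 : 𝕜) + (g.2 : 𝕜) * RCLike.I) := by
  have : Continuous (fun g : ℝ × ℝ => (g.1 : 𝕜) + (g.2 : 𝕜) * RCLike.I) := by fun_prop
  exact this.measurable

instance isProbabilityMeasure_stdNormal : IsProbabilityMeasure (stdNormal 𝕜) :=
  Measure.isProbabilityMeasure_map (measurable_stdNormal_map 𝕜).aemeasurable

instance isProbabilityMeasure_gaussianMatrix (d N : ℕ) :
    IsProbabilityMeasure (gaussianMatrix 𝕜 d N) :=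
  inferInstanceAs (IsProbabilityMeasure (Measure.pi fun _ : Fin d => Measure.pi fun _ : Fin N =>
    stdNormal 𝕜))

omit [MeasurableSpace 𝕜] [BorelSpace 𝕜] in
theorem re_conj_mul_add_mul_I (t : 𝕜) (a b : ℝ) :
    RCLike.re (star t * ((a : 𝕜) + (b : 𝕜) * RCLike.I)) = a * RCLike.re t + b * RCLike.im t := by
  rcases RCLike.I_eq_zero_or_im_I_eq_one (K := 𝕜) with h | h
  · have : RCLike.im t = 0 := by
      rw [← RCLike.re_add_im t, h]
      simp
    simp [h, this, mul_comm]
  · simp [h, mul_comm]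

theorem integral_exp_stdNormal (t : 𝕜) :
    ∫ x : 𝕜, Complex.exp ((RCLike.re (star t * x) : ℝ) * Complex.I) ∂(stdNormal 𝕜) =
      Complex.exp (-(‖t‖ ^ 2 / 2 : ℝ)) := by
  have hc : Continuous (fun x : 𝕜 => Complex.exp ((RCLike.re (star t * x) : ℝ) * Complex.I)) := by
    fun_prop
  rw [stdNormal, integral_map (measurable_stdNormal_map 𝕜).aemeasurable
    hc.aestronglyMeasurable]
  simp only [re_conj_mul_add_mul_I]
  have h : ∀ u : ℝ, ∫ a : ℝ, Complex.exp ((a * u : ℝ) * Complex.I) ∂(gaussianReal 0 1) =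
      Complex.exp (-(u ^ 2 / 2 : ℝ)) := fun u => by
    have := charFun_gaussianReal (μ := 0) (v := 1) u
    rw [charFun_apply_real] at this
    simp only [Complex.ofReal_zero, mul_zero, zero_mul, NNReal.coe_one, Complex.ofReal_one,
      one_mul, zero_sub] at this
    push_cast
    rw [← this]
    congr 1; ext a; congr 1; ring
  simp only [Complex.ofReal_add, add_mul, Complex.exp_add]
  rw [integral_prod_mul (μ := gaussianReal 0 1) (ν := gaussianReal 0 1)
    (fun a : ℝ => Complex.exp ((a * RCLike.re t : ℝ) * Complex.I))
    (fun a : ℝ => Complex.exp ((a * RCLike.im t : ℝ) * Complex.I)), h, h, ← Complex.exp_add,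
    RCLike.norm_sq_eq_def]
  congr 1
  push_cast
  ring

variable {d N : ℕ}

theorem integral_exp_pi_stdNormal (t : Fin N → 𝕜) :
    ∫ x : Fin N → 𝕜, Complex.exp ((RCLike.re (star t ⬝ᵥ x) : ℝ) * Complex.I)
      ∂(Measure.pi fun _ => stdNormal 𝕜) = Complex.exp (-((∑ i, ‖t i‖ ^ 2) / 2 : ℝ)) := by
  simp only [dotProduct, map_sum, Complex.ofReal_sum, Finset.sum_mul, Complex.exp_sum, Pi.star_apply]
  rw [integral_fintype_prod_eq_prod
    (f := fun i x => Complex.exp ((RCLike.re (star (t i) * x) : ℝ) * Complex.I))]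
  simp only [integral_exp_stdNormal, ← Complex.exp_sum]
  push_cast
  rw [Finset.sum_neg_distrib, Finset.sum_div]

/-- Only the Frobenius norm of T enters, which is the source of every invariance below. -/
theorem integral_exp_gaussianMatrix (T : Matrix (Fin d) (Fin N) 𝕜) :
    ∫ G : Matrix (Fin d) (Fin N) 𝕜, Complex.exp ((RCLike.re (Tᴴ * G).trace : ℝ) * Complex.I)
      ∂(gaussianMatrix 𝕜 d N) = Complex.exp (-(‖T‖ ^ 2 / 2 : ℝ)) := by
  have h : ∀ G : Matrix (Fin d) (Fin N) 𝕜, (Tᴴ * G).trace = ∑ i, star (T i) ⬝ᵥ G i := fun G => by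
    rw [Matrix.trace, Finset.sum_congr rfl fun j _ => Matrix.diag_apply _ j]
    simp only [Matrix.mul_apply, dotProduct]
    rw [Finset.sum_comm]
    rfl
  simp only [h, map_sum, Complex.ofReal_sum, Finset.sum_mul, Complex.exp_sum]
  have := integral_fintype_prod_eq_prod (ι := Fin d) (E := fun _ => Fin N → 𝕜)
    (μ := fun _ => Measure.pi fun _ => stdNormal 𝕜)
    (f := fun i x => Complex.exp ((RCLike.re (star (T i) ⬝ᵥ x) : ℝ) * Complex.I))
  refine this.trans ?_
  simp only [integral_exp_pi_stdNormal, ← Complex.exp_sum]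
  rw [frobenius_norm_sq]
  push_cast
  rw [Finset.sum_neg_distrib, Finset.sum_div]

-- Real-linear functionals are represented by the real part of the inner product, so that the
-- integrals above exhaust the characteristic function. Over the reals the term with `RCLike.I`
-- vanishes.
omit [MeasurableSpace 𝕜] [BorelSpace 𝕜] in
theorem exists_dual_eq_re (L : 𝕜 →ₗ[ℝ] ℝ) : ∃ t : 𝕜, ∀ x, L x = RCLike.re (star t * x) := by
  refine ⟨(L 1 : ℝ) + (L RCLike.I : ℝ) * RCLike.I, fun x => ?_⟩
  have hx : x = RCLike.re x • (1 : 𝕜) + RCLike.im x • (RCLike.I : 𝕜) := by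
    conv_lhs => rw [← RCLike.re_add_im x]
    simp [RCLike.real_smul_eq_coe_mul]
  have : RCLike.re (star (((L 1 : ℝ) : 𝕜) + (L RCLike.I : ℝ) * RCLike.I) * x) =
      RCLike.re (star x * (((L 1 : ℝ) : 𝕜) + (L RCLike.I : ℝ) * RCLike.I)) := by
    rw [← RCLike.conj_re, ← RCLike.star_def, star_mul, star_star]
  rw [this, re_conj_mul_add_mul_I]
  conv_lhs => rw [hx]
  simp only [map_add, map_smul, smul_eq_mul]
  ring

omit [MeasurableSpace 𝕜] [BorelSpace 𝕜] in
theorem exists_dual_pi_eq_re (L : (Fin N → 𝕜) →ₗ[ℝ] ℝ) :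
    ∃ t : Fin N → 𝕜, ∀ x, L x = RCLike.re (star t ⬝ᵥ x) := by
  choose t ht using fun i => exists_dual_eq_re (L ∘ₗ LinearMap.single ℝ (fun _ : Fin N => 𝕜) i)
  refine ⟨t, fun x => ?_⟩
  have hx : L x = ∑ i, L (LinearMap.single ℝ (fun _ : Fin N => 𝕜) i (x i)) := by
    rw [← map_sum]
    exact congrArg L (LinearMap.sum_single_apply (φ := fun _ : Fin N => 𝕜) x).symm
  rw [hx]
  simp only [dotProduct, map_sum, Pi.star_apply]
  exact Finset.sum_congr rfl fun i _ => ht i (x i)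

omit [MeasurableSpace 𝕜] [BorelSpace 𝕜] in
theorem exists_dual_matrix_eq_re (L : (Fin d → Fin N → 𝕜) →ₗ[ℝ] ℝ) :
    ∃ T : Matrix (Fin d) (Fin N) 𝕜, ∀ x : Matrix (Fin d) (Fin N) 𝕜,
      L x = RCLike.re (Tᴴ * x).trace := by
  choose t ht using fun i => exists_dual_pi_eq_re
    (L ∘ₗ LinearMap.single ℝ (fun _ : Fin d => Fin N → 𝕜) i)
  refine ⟨Matrix.of t, fun x => ?_⟩
  have hx : L x = ∑ i, L (LinearMap.single ℝ (fun _ : Fin d => Fin N → 𝕜) i (x i)) := by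
    rw [← map_sum]
    exact congrArg L (LinearMap.sum_single_apply (φ := fun _ : Fin d => Fin N → 𝕜) x).symm
  rw [hx, Matrix.trace, Finset.sum_congr rfl fun j _ => Matrix.diag_apply _ j]
  simp only [Matrix.mul_apply]
  rw [Finset.sum_comm, map_sum]
  refine Finset.sum_congr rfl fun i _ => ?_
  exact ht i (x i)

/-- A law on `𝕜 ^ N` with the characteristic function of the standard normal law is standard
normal. -/
theorem eq_pi_stdNormal_of_charFun {μ : Measure (Fin N → 𝕜)} [IsFiniteMeasure μ]
    (h : ∀ t : Fin N → 𝕜, ∫ x, Complex.exp ((RCLike.re (star t ⬝ᵥ x) : ℝ) * Complex.I) ∂μ =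
      Complex.exp (-((∑ i, ‖t i‖ ^ 2) / 2 : ℝ))) :
    μ = Measure.pi fun _ => stdNormal 𝕜 := by
  refine Measure.ext_of_charFunDual (funext fun L => ?_)
  obtain ⟨t, ht⟩ := exists_dual_pi_eq_re (L : (Fin N → 𝕜) →ₗ[ℝ] ℝ)
  simp only [charFunDual_apply]
  simp only [ContinuousLinearMap.coe_coe] at ht
  simp only [ht, h, integral_exp_pi_stdNormal]

theorem eq_gaussianMatrix_of_charFun {μ : Measure (Matrix (Fin d) (Fin N) 𝕜)} [IsFiniteMeasure μ]
    (h : ∀ T : Matrix (Fin d) (Fin N) 𝕜,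
      ∫ G, Complex.exp ((RCLike.re (Tᴴ * G).trace : ℝ) * Complex.I) ∂μ =
        Complex.exp (-(‖T‖ ^ 2 / 2 : ℝ))) :
    μ = gaussianMatrix 𝕜 d N := by
  -- Uniqueness is applied on the plain function space, with its product norm and Borel structure;
  -- the Frobenius norm enters only through the value of the integrals.
  have key : ∀ (μ ν : Measure (Fin d → Fin N → 𝕜)) [IsFiniteMeasure μ] [IsFiniteMeasure ν],
      (∀ T : Matrix (Fin d) (Fin N) 𝕜,
        ∫ G : Fin d → Fin N → 𝕜,
            Complex.exp ((RCLike.re (Tᴴ * (show Matrix (Fin d) (Fin N) 𝕜 from G)).trace : ℝ) * Complex.I) ∂μ =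
          ∫ G : Fin d → Fin N → 𝕜,
            Complex.exp ((RCLike.re (Tᴴ * (show Matrix (Fin d) (Fin N) 𝕜 from G)).trace : ℝ) * Complex.I) ∂ν) →
        μ = ν := by
    intro μ ν _ _ h
    refine Measure.ext_of_charFunDual (funext fun L => ?_)
    obtain ⟨T, hT⟩ := exists_dual_matrix_eq_re (L : (Fin d → Fin N → 𝕜) →ₗ[ℝ] ℝ)
    simp only [charFunDual_apply]
    have hL : ∀ x : Fin d → Fin N → 𝕜, Complex.exp ((L x : ℝ) * Complex.I) =
        Complex.exp ((RCLike.re (Tᴴ * (show Matrix (Fin d) (Fin N) 𝕜 from x)).trace : ℝ) *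
          Complex.I) := fun x => congrArg (fun r : ℝ => Complex.exp (r * Complex.I)) (hT x)
    exact (integral_congr_ae (.of_forall hL)).trans
      ((h T).trans (integral_congr_ae (.of_forall hL)).symm)
  have : IsFiniteMeasure (gaussianMatrix 𝕜 d N) := inferInstance
  exact @key μ (gaussianMatrix 𝕜 d N) ‹_› this fun T =>
    (h T).trans (integral_exp_gaussianMatrix T).symm

end GaussianLaw

/-! ### Measurability of matrix operations; invariance of Gaussian matrices -/

section GaussianInvariance

variable {𝕜 : Type*} [RCLike 𝕜] [MeasurableSpace 𝕜] [BorelSpace 𝕜]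

section Measurability

omit [RCLike 𝕜] [BorelSpace 𝕜] in
theorem measurable_matrix_iff {X I J : Type*} [MeasurableSpace X] {f : X → Matrix I J 𝕜} :
    Measurable f ↔ ∀ i j, Measurable fun x => f x i j := by
  constructor
  · intro h i j
    exact (measurable_pi_apply j).comp ((measurable_pi_apply i).comp h)
  · intro h
    exact measurable_pi_lambda _ fun i => measurable_pi_lambda _ fun j => h i j

omit [RCLike 𝕜] [BorelSpace 𝕜] in
theorem Measurable.matrix_elem {X I J : Type*} [MeasurableSpace X] {f : X → Matrix I J 𝕜}
    (hf : Measurable f) (i : I) (j : J) :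
    Measurable fun x => f x i j := measurable_matrix_iff.1 hf i j

variable {X I J K : Type*} [MeasurableSpace X]

theorem Measurable.matrix_mul [Fintype J] {f : X → Matrix I J 𝕜} {g : X → Matrix J K 𝕜} (hf : Measurable f)
    (hg : Measurable g) : Measurable fun x => f x * g x :=
  measurable_matrix_iff.2 fun i k => by
    simp only [Matrix.mul_apply]
    exact Finset.measurable_fun_sum _ fun j _ => (hf.matrix_elem i j).mul (hg.matrix_elem j k)

theorem Measurable.matrix_add {f g : X → Matrix I J 𝕜} (hf : Measurable f)
    (hg : Measurable g) : Measurable fun x => f x + g x :=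
  measurable_matrix_iff.2 fun i k => (hf.matrix_elem i k).add (hg.matrix_elem i k)

theorem Measurable.matrix_sub {f g : X → Matrix I J 𝕜} (hf : Measurable f)
    (hg : Measurable g) : Measurable fun x => f x - g x :=
  measurable_matrix_iff.2 fun i k => (hf.matrix_elem i k).sub (hg.matrix_elem i k)

theorem Measurable.matrix_conjTranspose {f : X → Matrix I J 𝕜} (hf : Measurable f) :
    Measurable fun x => (f x)ᴴ :=
  measurable_matrix_iff.2 fun i k => by
    simp only [Matrix.conjTranspose_apply]
    exact (continuous_star.measurable).comp (hf.matrix_elem k i)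

theorem Measurable.matrix_det [Fintype I] [DecidableEq I] {f : X → Matrix I I 𝕜} (hf : Measurable f) :
    Measurable fun x => (f x).det := by
  simp only [Matrix.det_apply']
  exact Finset.measurable_fun_sum _ fun σ _ => measurable_const.mul
    (Finset.measurable_fun_prod _ fun i _ => hf.matrix_elem _ _)

theorem Measurable.matrix_inv [Fintype I] [DecidableEq I] {f : X → Matrix I I 𝕜} (hf : Measurable f) :
    Measurable fun x => (f x)⁻¹ :=
  measurable_matrix_iff.2 fun i k => by
    simp only [Matrix.inv_def, Matrix.smul_apply, Ring.inverse_eq_inv', smul_eq_mul,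
      Matrix.adjugate_apply]
    refine hf.matrix_det.inv.mul (Measurable.matrix_det (measurable_matrix_iff.2 fun a b => ?_))
    by_cases h : a = k
    · subst h
      simp
    · simp only [Matrix.updateRow_ne h]
      exact hf.matrix_elem a b

theorem measurable_frobenius_norm [Fintype I] [Fintype J] : Measurable fun M : Matrix I J 𝕜 => ‖M‖ := by
  have : ∀ M : Matrix I J 𝕜, ‖M‖ = √(∑ i, ∑ j, ‖M i j‖ ^ 2) := fun M => by
    rw [← frobenius_norm_sq, Real.sqrt_sq (norm_nonneg _)]
  simp only [this]
  refine Real.continuous_sqrt.measurable.comp (Finset.measurable_fun_sum _ fun i _ =>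
    Finset.measurable_fun_sum _ fun j _ => ?_)
  exact (continuous_norm.measurable.comp (measurable_id.matrix_elem i j)).pow_const 2

end Measurability

variable {d N p : ℕ}

theorem measurable_exp_re_trace (T : Matrix (Fin d) (Fin N) 𝕜) :
    Measurable fun G : Matrix (Fin d) (Fin N) 𝕜 =>
      Complex.exp ((RCLike.re (Tᴴ * G).trace : ℝ) * Complex.I) := by
  have h : Measurable fun G : Matrix (Fin d) (Fin N) 𝕜 => (Tᴴ * G).trace :=
    Finset.measurable_fun_sum _ fun i _ =>
      ((measurable_const (a := Tᴴ)).matrix_mul measurable_id).matrix_elem i i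
  have h2 : Continuous fun z : 𝕜 => Complex.exp ((RCLike.re z : ℝ) * Complex.I) := by fun_prop
  exact h2.measurable.comp h

/-- Unitary invariance: if `V` has orthonormal columns and `G` is Gaussian, so is `G V`. -/
theorem measurePreserving_mul_isometry {V : Matrix (Fin N) (Fin p) 𝕜} (hV : Vᴴ * V = 1) :
    MeasurePreserving (fun G : Matrix (Fin d) (Fin N) 𝕜 => G * V) (gaussianMatrix 𝕜 d N)
      (gaussianMatrix 𝕜 d p) := by
  have hm : Measurable (fun G : Matrix (Fin d) (Fin N) 𝕜 => G * V) :=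
    measurable_id.matrix_mul measurable_const
  have := Measure.isProbabilityMeasure_map (μ := gaussianMatrix 𝕜 d N) hm.aemeasurable
  refine ⟨hm, eq_gaussianMatrix_of_charFun fun T => ?_⟩
  rw [integral_map hm.aemeasurable (measurable_exp_re_trace T).aestronglyMeasurable]
  have h := integral_exp_gaussianMatrix (T * Vᴴ)
  rw [frobenius_norm_mul_isometry hV] at h
  rw [← h]
  congr! 6 with G
  rw [Matrix.conjTranspose_mul, Matrix.conjTranspose_conjTranspose, Matrix.mul_assoc,
    Matrix.trace_mul_comm V, Matrix.mul_assoc]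

/-- Replacing one component of a Gaussian matrix by an independent copy. -/
theorem measurePreserving_resample {P : Matrix (Fin N) (Fin N) 𝕜} (hP : IsOrthProj P) :
    MeasurePreserving (fun G : Matrix (Fin d) (Fin N) 𝕜 × Matrix (Fin d) (Fin N) 𝕜 =>
      G.1 * P + G.2 * (1 - P)) ((gaussianMatrix 𝕜 d N).prod (gaussianMatrix 𝕜 d N))
      (gaussianMatrix 𝕜 d N) := by
  have hm : Measurable (fun G : Matrix (Fin d) (Fin N) 𝕜 × Matrix (Fin d) (Fin N) 𝕜 =>
      G.1 * P + G.2 * (1 - P)) :=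
    (measurable_fst.matrix_mul measurable_const).matrix_add
      (measurable_snd.matrix_mul measurable_const)
  have := Measure.isProbabilityMeasure_map
    (μ := (gaussianMatrix 𝕜 d N).prod (gaussianMatrix 𝕜 d N)) hm.aemeasurable
  refine ⟨hm, eq_gaussianMatrix_of_charFun fun T => ?_⟩
  rw [integral_map hm.aemeasurable (measurable_exp_re_trace T).aestronglyMeasurable]
  have h : ∀ G : Matrix (Fin d) (Fin N) 𝕜 × Matrix (Fin d) (Fin N) 𝕜,
      (Tᴴ * (G.1 * P + G.2 * (1 - P))).trace =
        ((T * P)ᴴ * G.1).trace + ((T * (1 - P))ᴴ * G.2).trace := fun G => by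
    rw [Matrix.mul_add, Matrix.trace_add, Matrix.conjTranspose_mul, Matrix.conjTranspose_mul,
      hP.hermitian, hP.compl.hermitian, Matrix.mul_assoc P, Matrix.trace_mul_comm P,
      Matrix.mul_assoc (1 - P), Matrix.trace_mul_comm (1 - P), Matrix.mul_assoc, Matrix.mul_assoc]
  simp only [h, map_add, Complex.ofReal_add, add_mul, Complex.exp_add]
  refine (integral_prod_mul (μ := gaussianMatrix 𝕜 d N) (ν := gaussianMatrix 𝕜 d N)
    (fun G : Matrix (Fin d) (Fin N) 𝕜 =>
      Complex.exp ((RCLike.re ((T * P)ᴴ * G).trace : ℝ) * Complex.I))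
    (fun G : Matrix (Fin d) (Fin N) 𝕜 =>
      Complex.exp ((RCLike.re ((T * (1 - P))ᴴ * G).trace : ℝ) * Complex.I))).trans ?_
  -- The two exponents add up by Pythagoras: ‖TP‖² + ‖T(1 - P)‖² = ‖T‖².
  rw [integral_exp_gaussianMatrix, integral_exp_gaussianMatrix, ← Complex.exp_add,
    hP.norm_sq_right T]
  congr 1
  push_cast
  ring

theorem measurePreserving_transpose_gaussianMatrix :
    MeasurePreserving (fun G : Matrix (Fin d) (Fin N) 𝕜 => Gᵀ) (gaussianMatrix 𝕜 d N)
      (gaussianMatrix 𝕜 N d) := by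
  have hm : Measurable (fun G : Matrix (Fin d) (Fin N) 𝕜 => Gᵀ) :=
    measurable_matrix_iff.2 fun i j => measurable_id.matrix_elem j i
  have := Measure.isProbabilityMeasure_map (μ := gaussianMatrix 𝕜 d N) hm.aemeasurable
  refine ⟨hm, eq_gaussianMatrix_of_charFun fun T => ?_⟩
  rw [integral_map hm.aemeasurable (measurable_exp_re_trace T).aestronglyMeasurable]
  have h := integral_exp_gaussianMatrix Tᵀ
  rw [Matrix.frobenius_norm_transpose] at h
  rw [← h]
  congr! 6 with G
  rw [← Matrix.trace_transpose, Matrix.transpose_mul, Matrix.transpose_transpose,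
    Matrix.trace_mul_comm]
  rfl

theorem measurePreserving_isometry_mulVec {V : Matrix (Fin N) (Fin p) 𝕜} (hV : Vᴴ * V = 1) :
    MeasurePreserving (fun g : Fin N → 𝕜 => Vᴴ *ᵥ g) (Measure.pi fun _ => stdNormal 𝕜)
      (Measure.pi fun _ => stdNormal 𝕜) := by
  have hc : Continuous (fun g : Fin N → 𝕜 => Vᴴ *ᵥ g) := by fun_prop
  have hm := hc.measurable
  have := Measure.isProbabilityMeasure_map (μ := Measure.pi fun _ : Fin N => stdNormal 𝕜)
    hm.aemeasurable
  refine ⟨hm, eq_pi_stdNormal_of_charFun fun t => ?_⟩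
  have hc' : Continuous fun g : Fin p → 𝕜 =>
      Complex.exp ((RCLike.re (star t ⬝ᵥ g) : ℝ) * Complex.I) := by
    simp only [dotProduct]
    fun_prop
  rw [integral_map hm.aemeasurable hc'.aestronglyMeasurable]
  have h := integral_exp_pi_stdNormal (V *ᵥ t)
  have h1 : ∑ i, ‖(V *ᵥ t) i‖ ^ 2 = ∑ i, ‖t i‖ ^ 2 := by
    have := frobenius_norm_isometry_mul hV (Matrix.replicateCol Unit t)
    have := congrArg (· ^ 2) this
    simpa [frobenius_norm_sq, Matrix.mul_apply, Matrix.mulVec, dotProduct,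
      EuclideanSpace.norm_sq_eq] using this
  rw [h1] at h
  rw [← h]
  congr! 6 with g
  rw [Matrix.star_mulVec, Matrix.dotProduct_mulVec]

/-- A linear functional of a Gaussian matrix is a scaled standard normal variable. -/
theorem map_trace_mul_gaussianMatrix (T : Matrix (Fin d) (Fin N) 𝕜) :
    (gaussianMatrix 𝕜 d N).map (fun G => (Tᴴ * G).trace) =
      (stdNormal 𝕜).map (fun x => (‖T‖ : 𝕜) * x) := by
  have h : Measurable fun G : Matrix (Fin d) (Fin N) 𝕜 => (Tᴴ * G).trace :=
    Finset.measurable_fun_sum _ fun i _ =>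
      ((measurable_const (a := Tᴴ)).matrix_mul measurable_id).matrix_elem i i
  have h' : Measurable fun x : 𝕜 => (‖T‖ : 𝕜) * x := measurable_const.mul measurable_id
  have := Measure.isProbabilityMeasure_map (μ := gaussianMatrix 𝕜 d N) h.aemeasurable
  have := Measure.isProbabilityMeasure_map (μ := stdNormal 𝕜) h'.aemeasurable
  refine Measure.ext_of_charFunDual (funext fun L => ?_)
  obtain ⟨t, ht⟩ := exists_dual_eq_re (L : 𝕜 →ₗ[ℝ] ℝ)
  simp only [ContinuousLinearMap.coe_coe] at ht
  have hc : Continuous fun x : 𝕜 => Complex.exp ((RCLike.re (star t * x) : ℝ) * Complex.I) := by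
    fun_prop
  simp only [charFunDual_apply, ht]
  rw [integral_map h.aemeasurable hc.aestronglyMeasurable,
    integral_map h'.aemeasurable hc.aestronglyMeasurable]
  have e1 := integral_exp_gaussianMatrix (t • T)
  have e2 := integral_exp_stdNormal ((‖T‖ : 𝕜) * t)
  have e3 : ‖(‖T‖ : 𝕜) * t‖ = ‖t • T‖ := by
    rw [norm_smul, norm_mul, mul_comm]
    simp
  rw [e3, ← e1] at e2
  rw [Matrix.conjTranspose_smul] at e2
  simp only [Matrix.smul_mul, Matrix.trace_smul, smul_eq_mul, star_mul', RCLike.star_def,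
    RCLike.conj_ofReal] at e2 ⊢
  rw [← e2]
  congr! 6 with x
  ring

end GaussianInvariance

/-! ### Second moments and inverse chi-squared moments -/

section ScalarMoments

variable (𝕜 : Type*) [RCLike 𝕜]

theorem fieldAlpha_le_one : fieldAlpha 𝕜 ≤ 1 := by
  unfold fieldAlpha
  split_ifs <;> simp

/-- The dimension of `𝕜` over `ℝ`, written through `fieldAlpha`. -/
def realDim : ℝ := 2 - fieldAlpha 𝕜

variable {𝕜}

theorem norm_sq_add_mul_I (a b : ℝ) :
    ‖(a : 𝕜) + (b : 𝕜) * RCLike.I‖ ^ 2 = a ^ 2 + (1 - fieldAlpha 𝕜) * b ^ 2 := by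
  rw [RCLike.norm_sq_eq_def]
  rcases RCLike.I_eq_zero_or_im_I_eq_one (K := 𝕜) with h | h
  · simp [h, fieldAlpha, pow_two]
  · have : (RCLike.I : 𝕜) ≠ 0 := fun h0 => by simp [h0] at h
    simp [h, fieldAlpha, this, pow_two]

variable [MeasurableSpace 𝕜] [BorelSpace 𝕜]

theorem lintegral_sq_gaussianReal :
    ∫⁻ x : ℝ, ENNReal.ofReal (x ^ 2) ∂(gaussianReal 0 1) = 1 := by
  have hint : Integrable (fun x : ℝ => x ^ 2) (gaussianReal 0 1) :=
    (memLp_id_gaussianReal 2).integrable_sq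
  rw [← ofReal_integral_eq_lintegral_ofReal hint (.of_forall fun x => sq_nonneg x)]
  have h := variance_id_gaussianReal (μ := 0) (v := 1)
  rw [variance_of_integral_eq_zero aemeasurable_id (by simp)] at h
  simp only [id, NNReal.coe_one] at h
  simp [h]

theorem lintegral_norm_sq_stdNormal :
    ∫⁻ x : 𝕜, ENNReal.ofReal (‖x‖ ^ 2) ∂(stdNormal 𝕜) = ENNReal.ofReal (realDim 𝕜) := by
  have hα : (0 : ℝ) ≤ 1 - fieldAlpha 𝕜 := by
    have : (fieldAlpha 𝕜 : ℝ) ≤ 1 := by exact_mod_cast fieldAlpha_le_one 𝕜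
    linarith
  rw [stdNormal, lintegral_map (by fun_prop) (measurable_stdNormal_map 𝕜)]
  simp only [norm_sq_add_mul_I]
  have : ∀ g : ℝ × ℝ, ENNReal.ofReal (g.1 ^ 2 + (1 - fieldAlpha 𝕜) * g.2 ^ 2) =
      ENNReal.ofReal (g.1 ^ 2) +
        ENNReal.ofReal (1 - fieldAlpha 𝕜) * ENNReal.ofReal (g.2 ^ 2) := fun g => by
    rw [ENNReal.ofReal_add (by positivity) (by positivity), ENNReal.ofReal_mul hα]
  simp only [this]
  rw [lintegral_add_left (by fun_prop), lintegral_const_mul _ (by fun_prop),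
    lintegral_prod _ (by fun_prop), lintegral_prod _ (by fun_prop)]
  simp only [lintegral_const, measure_univ, mul_one, lintegral_sq_gaussianReal]
  rw [realDim, ← ENNReal.ofReal_one, ← ENNReal.ofReal_add zero_le_one hα]
  congr 1
  ring

theorem integral_exp_neg_sq_gaussianReal {t : ℝ} (ht : 0 ≤ t) :
    ∫ x : ℝ, Real.exp (-t * x ^ 2) ∂(gaussianReal 0 1) = (1 + 2 * t) ^ (-(1 / 2) : ℝ) := by
  rw [integral_gaussianReal_eq_integral_smul one_ne_zero]
  have : ∀ x : ℝ, gaussianPDFReal 0 1 x • Real.exp (-t * x ^ 2) =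
      (√(2 * Real.pi))⁻¹ * Real.exp (-(1 / 2 + t) * x ^ 2) := fun x => by
    rw [gaussianPDFReal_def]
    simp only [NNReal.coe_one, mul_one, sub_zero, smul_eq_mul, mul_assoc, ← Real.exp_add]
    congr 2
    ring
  simp only [this]
  rw [integral_const_mul, integral_gaussian, ← Real.sqrt_inv, ← Real.sqrt_mul (by positivity),
    Real.rpow_neg (by positivity), ← Real.sqrt_eq_rpow, ← Real.sqrt_inv]
  congr 1
  field_simp

theorem integral_exp_neg_norm_sq_stdNormal {t : ℝ} (ht : 0 ≤ t) :
    ∫ x : 𝕜, Real.exp (-t * ‖x‖ ^ 2) ∂(stdNormal 𝕜) = (1 + 2 * t) ^ (-(realDim 𝕜 / 2)) := by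
  have hc : Continuous fun x : 𝕜 => Real.exp (-t * ‖x‖ ^ 2) := by fun_prop
  rw [stdNormal, integral_map (measurable_stdNormal_map 𝕜).aemeasurable hc.aestronglyMeasurable]
  simp only [norm_sq_add_mul_I, mul_add, Real.exp_add]
  rw [integral_prod_mul (μ := gaussianReal 0 1) (ν := gaussianReal 0 1)
    (fun a : ℝ => Real.exp (-t * a ^ 2))
    (fun a : ℝ => Real.exp (-t * ((1 - fieldAlpha 𝕜) * a ^ 2))),
    integral_exp_neg_sq_gaussianReal ht]
  rcases Nat.le_one_iff_eq_zero_or_eq_one.1 (fieldAlpha_le_one 𝕜) with h | h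
  · simp only [realDim, h, Nat.cast_zero, sub_zero, one_mul, integral_exp_neg_sq_gaussianReal ht]
    rw [← Real.rpow_add (by positivity)]
    norm_num
  · simp [realDim, h]
    norm_num

theorem integral_exp_neg_sum_sq {N : ℕ} {t : ℝ} (ht : 0 ≤ t) :
    ∫ h : Fin N → 𝕜, Real.exp (-t * ∑ i, ‖h i‖ ^ 2) ∂(Measure.pi fun _ => stdNormal 𝕜) =
      (1 + 2 * t) ^ (-(realDim 𝕜 * N / 2)) := by
  simp only [Finset.mul_sum, Real.exp_sum]
  rw [integral_fintype_prod_eq_pow (f := fun x : 𝕜 => Real.exp (-t * ‖x‖ ^ 2)),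
    integral_exp_neg_norm_sq_stdNormal ht, ← Real.rpow_natCast, ← Real.rpow_mul (by positivity)]
  congr 1
  simp
  ring

/-- Writes 1/x as a Laplace integral, whose integrand factorizes over coordinates when x is a sum of
squares. At x = 0 both sides are ∞. -/
theorem lintegral_exp_neg_mul_Ioi {x : ℝ} (hx : 0 ≤ x) :
    ∫⁻ t in Set.Ioi (0 : ℝ), ENNReal.ofReal (Real.exp (-t * x)) = (ENNReal.ofReal x)⁻¹ := by
  rcases hx.eq_or_lt with rfl | hx
  · simp
  have hint := exp_neg_integrableOn_Ioi 0 hx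
  have := integral_exp_mul_Ioi (a := -x) (by linarith) 0
  have e : ∀ t : ℝ, -t * x = -x * t := fun t => by ring
  simp only [e]
  rw [← ofReal_integral_eq_lintegral_ofReal hint (.of_forall fun t => (Real.exp_pos _).le), this,
    ← ENNReal.ofReal_inv_of_pos hx]
  congr 1
  simp

/-- An antiderivative is -(1 + 2t)^(1 - c)/(2c - 2). It is used with c = βN/2, where β is `realDim
𝕜`, and c > 1 is exactly the condition for a finite inverse moment. -/
theorem lintegral_rpow_Ioi {c : ℝ} (hc : 1 < c) :
    ∫⁻ t in Set.Ioi (0 : ℝ), ENNReal.ofReal ((1 + 2 * t) ^ (-c)) =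
      ENNReal.ofReal (1 / (2 * c - 2)) := by
  have hd : ∀ t ∈ Set.Ici (0 : ℝ), HasDerivAt (fun t : ℝ => -(1 + 2 * t) ^ (1 - c) / (2 * c - 2))
      ((1 + 2 * t) ^ (-c)) t := fun t ht => by
    have ht : (0 : ℝ) ≤ t := ht
    have h1 : HasDerivAt (fun t : ℝ => 1 + 2 * t) 2 t := by
      simpa using ((hasDerivAt_id t).const_mul 2).const_add 1
    have h2 := ((h1.rpow_const (p := 1 - c) (Or.inl (by positivity))).neg).div_const (2 * c - 2)
    refine h2.congr_deriv ?_
    rw [show 1 - c - 1 = -c by ring]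
    have : 2 * c - 2 ≠ 0 := by linarith
    rw [div_eq_iff this]
    ring
  have hl : Filter.Tendsto (fun t : ℝ => -(1 + 2 * t) ^ (1 - c) / (2 * c - 2)) Filter.atTop
      (nhds 0) := by
    have h1 : Filter.Tendsto (fun t : ℝ => 1 + 2 * t) Filter.atTop Filter.atTop :=
      Filter.tendsto_atTop_add_const_left _ _
        (Filter.tendsto_id.const_mul_atTop (by norm_num))
    have h2 := (tendsto_rpow_neg_atTop (y := c - 1) (by linarith)).comp h1
    have h3 := (h2.neg).div_const (2 * c - 2)
    simpa [Function.comp_def] using h3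
  have hpos : ∀ t ∈ Set.Ioi (0 : ℝ), 0 ≤ (1 + 2 * t) ^ (-c) := fun t ht => by
    have ht : (0 : ℝ) < t := ht
    positivity
  have hint := integrableOn_Ioi_deriv_of_nonneg' hd hpos hl
  rw [← ofReal_integral_eq_lintegral_ofReal hint
    (ae_restrict_of_forall_mem measurableSet_Ioi hpos),
    integral_Ioi_of_hasDerivAt_of_nonneg' hd hpos hl]
  congr 1
  simp [neg_div]

/-- The first inverse moment of a chi-squared variable. -/
theorem lintegral_inv_sum_sq {N : ℕ} (hN : 2 < realDim 𝕜 * N) :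
    ∫⁻ h : Fin N → 𝕜, (ENNReal.ofReal (∑ i, ‖h i‖ ^ 2))⁻¹ ∂(Measure.pi fun _ => stdNormal 𝕜) =
      ENNReal.ofReal (1 / (realDim 𝕜 * N - 2)) := by
  have h1 : ∀ h : Fin N → 𝕜, (ENNReal.ofReal (∑ i, ‖h i‖ ^ 2))⁻¹ =
      ∫⁻ t in Set.Ioi (0 : ℝ), ENNReal.ofReal (Real.exp (-t * ∑ i, ‖h i‖ ^ 2)) := fun h =>
    (lintegral_exp_neg_mul_Ioi (by positivity)).symm
  simp only [h1]
  have hc : Continuous fun z : (Fin N → 𝕜) × ℝ => Real.exp (-z.2 * ∑ i, ‖z.1 i‖ ^ 2) := by fun_prop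
  rw [lintegral_lintegral_swap hc.measurable.ennreal_ofReal.aemeasurable]
  have h2 : ∀ t ∈ Set.Ioi (0 : ℝ),
      ∫⁻ h : Fin N → 𝕜, ENNReal.ofReal (Real.exp (-t * ∑ i, ‖h i‖ ^ 2))
        ∂(Measure.pi fun _ => stdNormal 𝕜) =
      ENNReal.ofReal ((1 + 2 * t) ^ (-(realDim 𝕜 * N / 2))) := fun t ht => by
    have ht : (0 : ℝ) < t := ht
    rw [← integral_exp_neg_sum_sq ht.le, ofReal_integral_eq_lintegral_ofReal]
    · have hc : Continuous fun h : Fin N → 𝕜 => Real.exp (-t * ∑ i, ‖h i‖ ^ 2) := by fun_prop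
      refine Integrable.of_bound hc.aestronglyMeasurable 1 (.of_forall fun h => ?_)
      rw [Real.norm_eq_abs, Real.abs_exp, Real.exp_le_one_iff, neg_mul, neg_nonpos]
      positivity
    · exact .of_forall fun h => (Real.exp_pos _).le
  rw [setLIntegral_congr_fun measurableSet_Ioi h2, lintegral_rpow_Ioi (by linarith)]
  congr 2
  ring

end ScalarMoments

/-! ### Left inverses and diagonal entries of inverse Gram matrices -/

section GaussianInverse

variable {𝕜 : Type*} [RCLike 𝕜]

/-- The least-squares left inverse `(GᴴG)⁻¹Gᴴ`; it equals the pseudoinverse if `G` has full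
column rank. -/
noncomputable def leftInv {I J : Type*} [Fintype I] [Fintype J] [DecidableEq J] (G : Matrix I J 𝕜) :
    Matrix J I 𝕜 := (Gᴴ * G)⁻¹ * Gᴴ

section Deterministic

variable {I J K : Type*} [Fintype I] [Fintype J] [DecidableEq J] [Fintype K] [DecidableEq K]

theorem leftInv_mul {G : Matrix I J 𝕜} (h : IsUnit (Gᴴ * G).det) : leftInv G * G = 1 := by
  rw [leftInv, Matrix.mul_assoc, Matrix.nonsing_inv_mul _ h]

theorem inv_conjTranspose_mul_self (G : Matrix I J 𝕜) : ((Gᴴ * G)⁻¹)ᴴ = (Gᴴ * G)⁻¹ := by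
  rw [Matrix.conjTranspose_nonsing_inv, Matrix.conjTranspose_mul, Matrix.conjTranspose_conjTranspose]

theorem leftInv_mul_conjTranspose (G : Matrix I J 𝕜) :
    leftInv G * (leftInv G)ᴴ = (Gᴴ * G)⁻¹ := by
  by_cases h : IsUnit (Gᴴ * G).det
  · conv_lhs => rw [leftInv, Matrix.conjTranspose_mul, inv_conjTranspose_mul_self,
      Matrix.conjTranspose_conjTranspose, Matrix.mul_assoc, ← Matrix.mul_assoc Gᴴ,
      Matrix.mul_nonsing_inv _ h, Matrix.mul_one]
  -- In the singular case the matrix inverse is 0 by convention, and both sides vanish.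
  · rw [leftInv, Matrix.nonsing_inv_apply_not_isUnit _ h]
    simp

theorem inv_diag_eq_sum (G : Matrix I J 𝕜) (j : J) :
    (Gᴴ * G)⁻¹ j j = ((∑ i, ‖leftInv G j i‖ ^ 2 : ℝ) : 𝕜) := by
  rw [← leftInv_mul_conjTranspose, Matrix.mul_apply]
  push_cast
  refine Finset.sum_congr rfl fun i _ => ?_
  rw [Matrix.conjTranspose_apply, RCLike.star_def, RCLike.mul_conj]

theorem norm_leftInv_sq (G : Matrix I J 𝕜) :
    ‖leftInv G‖ ^ 2 = ∑ j, RCLike.re ((Gᴴ * G)⁻¹ j j) := by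
  rw [frobenius_norm_sq]
  refine Finset.sum_congr rfl fun j _ => ?_
  rw [inv_diag_eq_sum, RCLike.ofReal_re]

/-- If `Vᴴ` annihilates the columns of `G` other than column `j`, then the `j`-th diagonal entry
of `(GᴴG)⁻¹` is at most `1 / ‖Vᴴ g_j‖²`. -/
theorem inv_diag_mul_le_one {G : Matrix I J 𝕜} {V : Matrix I K 𝕜} (hV : Vᴴ * V = 1) {j : J}
    (hVG : ∀ a, ∀ i ≠ j, (Vᴴ * G) a i = 0) :
    RCLike.re ((Gᴴ * G)⁻¹ j j) * ∑ a, ‖(Vᴴ * G) a j‖ ^ 2 ≤ 1 := by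
  classical
  set x : ℝ := ∑ i, ‖leftInv G j i‖ ^ 2 with hx
  have hX : (Gᴴ * G)⁻¹ j j = (x : 𝕜) := inv_diag_eq_sum G j
  set y : ℝ := ∑ a, ‖(Vᴴ * G) a j‖ ^ 2 with hy
  have hx0 : 0 ≤ x := by positivity
  rw [hX, RCLike.ofReal_re]
  -- U is the column G(GᴴG)⁻¹e_j, with ‖U‖² = x. Since Vᴴ annihilates the other columns of G, VᴴU =
  -- x·Vᴴg_j, so the contraction ‖VᴴU‖ ≤ ‖U‖ reads x²y ≤ x. No invertibility is needed, since x = 0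
  -- in the singular case.
  let U : Matrix I Unit 𝕜 := (leftInv G)ᴴ.submatrix id fun _ => j
  have hU : ‖U‖ ^ 2 = x := by
    simp [frobenius_norm_sq, U, hx]
  have hVU : ‖Vᴴ * U‖ ^ 2 = x ^ 2 * y := by
    have e : (leftInv G)ᴴ = G * (Gᴴ * G)⁻¹ := by
      rw [leftInv, Matrix.conjTranspose_mul, inv_conjTranspose_mul_self,
        Matrix.conjTranspose_conjTranspose]
    have e2 : ∀ a u, (Vᴴ * U) a u = (Vᴴ * G) a j * (x : 𝕜) := fun a u => by
      have : (Vᴴ * U) a u = (Vᴴ * G * (Gᴴ * G)⁻¹) a j := by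
        rw [Matrix.mul_assoc, ← e]
        rfl
      rw [this, Matrix.mul_apply, Finset.sum_eq_single j, hX]
      · intro i _ hi
        rw [hVG a i hi, zero_mul]
      · simp
    simp only [frobenius_norm_sq, e2, norm_mul, RCLike.norm_ofReal, abs_of_nonneg hx0, mul_pow]
    rw [hy, Finset.mul_sum]
    simp [mul_comm]
  have hle : ‖Vᴴ * U‖ ^ 2 ≤ ‖U‖ ^ 2 := by
    refine pow_le_pow_left₀ (norm_nonneg _) ?_ 2
    rw [← frobenius_norm_isometry_mul hV, ← Matrix.mul_assoc]
    exact (IsOrthProj.of_isometry hV).norm_mul_le U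
  rw [hVU, hU] at hle
  rcases hx0.eq_or_lt with h | h
  · rw [← h]
    simp
  · nlinarith

open scoped ComplexOrder in
theorem linearIndependent_col_iff_isUnit_det (G : Matrix I J 𝕜) :
    LinearIndependent 𝕜 G.col ↔ IsUnit (Gᴴ * G).det := by
  rw [← Matrix.mulVec_injective_iff, ← Matrix.isUnit_iff_isUnit_det,
    ← Matrix.mulVec_injective_iff_isUnit]
  constructor
  · intro h
    rw [← Matrix.coe_mulVecLin, ← LinearMap.ker_eq_bot, LinearMap.ker_eq_bot']
    intro v hv
    rw [Matrix.mulVecLin_apply, Matrix.conjTranspose_mul_self_mulVec_eq_zero] at hv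
    exact h (by simpa using hv)
  · intro h v w hvw
    apply h
    simp only [← Matrix.mulVec_mulVec]
    exact congrArg _ hvw

end Deterministic

/-- The orthogonal complement of k vectors has dimension at least s - k ≥ N. -/
theorem exists_isometry_orthogonal {s k N : ℕ} (w : Fin k → Fin s → 𝕜) (hN : N + k ≤ s) :
    ∃ V : Matrix (Fin s) (Fin N) 𝕜, Vᴴ * V = 1 ∧ ∀ i, Vᴴ *ᵥ w i = 0 := by
  let W : Submodule 𝕜 (EuclideanSpace 𝕜 (Fin s)) :=
    Submodule.span 𝕜 (Set.range fun i => WithLp.toLp 2 (w i))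
  have h1 : Module.finrank 𝕜 W ≤ k := by
    have := finrank_range_le_card (R := 𝕜) (fun i => (WithLp.toLp 2 (w i) : EuclideanSpace 𝕜 (Fin s)))
    rwa [Fintype.card_fin] at this
  have h2 := W.finrank_add_finrank_orthogonal
  rw [finrank_euclideanSpace_fin] at h2
  have h3 : N ≤ Module.finrank 𝕜 Wᗮ := by omega
  let b := stdOrthonormalBasis 𝕜 Wᗮ
  let v : Fin N → EuclideanSpace 𝕜 (Fin s) := fun a => (b (Fin.castLE h3 a) : EuclideanSpace 𝕜 (Fin s))
  have hv : Orthonormal 𝕜 v :=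
    (b.orthonormal.comp _ (Fin.castLE_injective h3)).comp_linearIsometry Wᗮ.subtypeₗᵢ
  refine ⟨Matrix.of fun i a => v a i, ?_, fun i => ?_⟩
  · ext a c
    have := orthonormal_iff_ite.1 hv a c
    rw [EuclideanSpace.inner_eq_star_dotProduct] at this
    rw [Matrix.one_apply, ← this]
    simp [Matrix.mul_apply, dotProduct, mul_comm]
  · ext a
    have hw : WithLp.toLp 2 (w i) ∈ W := Submodule.subset_span ⟨i, rfl⟩
    have := Submodule.inner_left_of_mem_orthogonal hw (b (Fin.castLE h3 a)).2
    rw [EuclideanSpace.inner_eq_star_dotProduct] at this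
    simpa [Matrix.mulVec, dotProduct, mul_comm] using this

end GaussianInverse

/-! ### Inverse moments of Gaussian matrices -/

section InverseWishart

variable {𝕜 : Type*} [RCLike 𝕜] [MeasurableSpace 𝕜] [BorelSpace 𝕜] {s k : ℕ}

/-- Tonelli with row j integrated innermost: the other rows are frozen, and subspaces built from
them are deterministic. -/
theorem lintegral_gaussianMatrix_succ {f : Matrix (Fin (k + 1)) (Fin s) 𝕜 → ENNReal}
    (hf : Measurable f) (j : Fin (k + 1)) :
    ∫⁻ M, f M ∂(gaussianMatrix 𝕜 (k + 1) s) =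
      ∫⁻ w : Matrix (Fin k) (Fin s) 𝕜, ∫⁻ g : Fin s → 𝕜,
        f (Matrix.of (j.insertNth g w.row)) ∂(Measure.pi fun _ => stdNormal 𝕜)
          ∂(gaussianMatrix 𝕜 k s) := by
  have h := (measurePreserving_piFinSuccAbove
    (fun _ : Fin (k + 1) => Measure.pi fun _ : Fin s => stdNormal 𝕜) j).symm
  have hf' : Measurable fun x : Fin (k + 1) → Fin s → 𝕜 => f (Matrix.of x) := hf
  have h1 := h.lintegral_comp hf'
  refine h1.symm.trans ?_
  exact lintegral_prod_symm _ (hf'.comp h.measurable).aemeasurable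

theorem ae_ne_zero_stdNormal : ∀ᵐ x : 𝕜 ∂(stdNormal 𝕜), x ≠ 0 := by
  have hm : MeasurableSet {x : 𝕜 | x ≠ 0} := (measurableSet_singleton 0).compl
  rw [stdNormal, ae_map_iff (measurable_stdNormal_map 𝕜).aemeasurable hm]
  have h0 : ∀ᵐ x : ℝ ∂(gaussianReal 0 1), x ≠ 0 := by
    have := nullSingletonClass_gaussianReal (μ := 0) (v := 1) one_ne_zero
    rw [ae_iff]
    simp
  have h1 := (Measure.quasiMeasurePreserving_fst (μ := gaussianReal 0 1)
    (ν := gaussianReal 0 1)).ae h0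
  filter_upwards [h1] with g hg h
  apply hg
  have h2 := norm_sq_add_mul_I (𝕜 := 𝕜) g.1 g.2
  have hα : (fieldAlpha 𝕜 : ℝ) ≤ 1 := by exact_mod_cast fieldAlpha_le_one 𝕜
  rw [h, norm_zero] at h2
  nlinarith [sq_nonneg g.1, mul_nonneg (sub_nonneg.2 hα) (sq_nonneg g.2)]

theorem measurable_leftInv {I J : Type*} [Fintype I] [Fintype J] [DecidableEq J] :
    Measurable (leftInv : Matrix I J 𝕜 → Matrix J I 𝕜) :=
  (measurable_id.matrix_conjTranspose.matrix_mul measurable_id).matrix_inv.matrix_mul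
    measurable_id.matrix_conjTranspose

theorem measurableSet_isUnit_det {I J : Type*} [Fintype I] [Fintype J] [DecidableEq J] :
    MeasurableSet {G : Matrix I J 𝕜 | IsUnit (Gᴴ * G).det} := by
  simp only [isUnit_iff_ne_zero]
  exact (measurable_id.matrix_conjTranspose.matrix_mul measurable_id).matrix_det
    (measurableSet_singleton 0).compl

omit [RCLike 𝕜] [BorelSpace 𝕜] in
theorem measurable_matrix_transpose {I J : Type*} :
    Measurable (Matrix.transpose : Matrix I J 𝕜 → Matrix J I 𝕜) :=
  measurable_matrix_iff.2 fun i j => measurable_id.matrix_elem j i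

/-- A new row g lies in the span of the previous ones only if its component along a fixed unit
vector orthogonal to them vanishes; that component is a standard normal scalar. -/
theorem ae_linearIndependent_row (hk : k ≤ s) :
    ∀ᵐ M : Matrix (Fin k) (Fin s) 𝕜 ∂(gaussianMatrix 𝕜 k s), LinearIndependent 𝕜 M.row := by
  have hiff : ∀ {k : ℕ} (M : Matrix (Fin k) (Fin s) 𝕜),
      LinearIndependent 𝕜 M.row ↔ IsUnit (Mᵀᴴ * Mᵀ).det := fun M =>
    linearIndependent_col_iff_isUnit_det Mᵀ
  induction k with
  | zero => exact .of_forall fun M => linearIndependent_empty_type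
  | succ k ih =>
    have hB : MeasurableSet {M : Matrix (Fin (k + 1)) (Fin s) 𝕜 | ¬ LinearIndependent 𝕜 M.row} := by
      simp only [hiff]
      exact (measurable_matrix_transpose measurableSet_isUnit_det).compl
    rw [ae_iff, ← lintegral_indicator_one hB,
      lintegral_gaussianMatrix_succ (measurable_one.indicator hB) 0]
    refine (lintegral_congr_ae ?_).trans lintegral_zero
    filter_upwards [ih (by omega)] with w hw
    refine (lintegral_congr_ae ?_).trans lintegral_zero
    obtain ⟨V, hV, hVw⟩ := exists_isometry_orthogonal (N := 1) w.row (by omega)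
    have h1 := (measurePreserving_eval (fun _ : Fin 1 => stdNormal 𝕜) 0).quasiMeasurePreserving.ae
      ae_ne_zero_stdNormal
    have h2 := (measurePreserving_isometry_mulVec hV).quasiMeasurePreserving.ae h1
    filter_upwards [h2] with g hg
    refine Set.indicator_of_notMem ?_ _
    simp only [Set.mem_ofPred_eq, not_not]
    have : (Matrix.of (Fin.insertNth (0 : Fin (k + 1)) g w.row)).row = (Fin.cons g w.row : Fin (k + 1) → Fin s → 𝕜) := by
      rw [Fin.insertNth_zero']
      rfl
    rw [this, linearIndependent_finCons]
    refine ⟨hw, fun hmem => hg ?_⟩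
    have hle : Submodule.span 𝕜 (Set.range w.row) ≤ LinearMap.ker Vᴴ.mulVecLin := by
      rw [Submodule.span_le]
      rintro _ ⟨i, rfl⟩
      exact hVw i
    have := hle hmem
    rw [LinearMap.mem_ker, Matrix.mulVecLin_apply] at this
    exact congrFun this 0

theorem ae_isUnit_det_gaussianMatrix (hk : k ≤ s) :
    ∀ᵐ G : Matrix (Fin s) (Fin k) 𝕜 ∂(gaussianMatrix 𝕜 s k), IsUnit (Gᴴ * G).det := by
  have h := measurePreserving_transpose_gaussianMatrix (𝕜 := 𝕜) (d := s) (N := k)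
  filter_upwards [h.quasiMeasurePreserving.ae (ae_linearIndependent_row hk)] with G hG
  exact (linearIndependent_col_iff_isUnit_det G).1 hG

/-- With the other k columns of Mᵀ frozen, let V be an orthonormal family of s - k vectors
orthogonal to them. The entry is at most 1/‖Vᴴg‖², and Vᴴg is standard normal in dimension s - k
whatever the frozen columns are, so an inverse chi-squared moment bounds the inner integral
uniformly. -/
theorem lintegral_inv_diag_le (hs : k + 1 + fieldAlpha 𝕜 < s) (j : Fin (k + 1)) :
    ∫⁻ M : Matrix (Fin (k + 1)) (Fin s) 𝕜,
        ENNReal.ofReal (RCLike.re ((Mᵀᴴ * Mᵀ)⁻¹ j j)) ∂(gaussianMatrix 𝕜 (k + 1) s) ≤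
      ENNReal.ofReal (1 / (realDim 𝕜 * (s - (k + 1) - fieldAlpha 𝕜))) := by
  have hm : Measurable fun M : Matrix (Fin (k + 1)) (Fin s) 𝕜 =>
      ENNReal.ofReal (RCLike.re ((Mᵀᴴ * Mᵀ)⁻¹ j j)) :=
    (RCLike.continuous_re.measurable.comp ((measurable_matrix_transpose.matrix_conjTranspose.matrix_mul
      measurable_matrix_transpose).matrix_inv.matrix_elem j j)).ennreal_ofReal
  rw [lintegral_gaussianMatrix_succ hm j]
  refine (lintegral_mono (g := fun _ =>
    ENNReal.ofReal (1 / (realDim 𝕜 * (s - (k + 1) - fieldAlpha 𝕜)))) fun w => ?_).trans (by simp)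
  obtain ⟨V, hV, hVw⟩ := exists_isometry_orthogonal (N := s - k) w.row (by omega)
  have hle : ∀ g : Fin s → 𝕜,
      ENNReal.ofReal (RCLike.re (((Matrix.of (j.insertNth g w.row))ᵀᴴ *
        (Matrix.of (j.insertNth g w.row))ᵀ)⁻¹ j j)) ≤
      (ENNReal.ofReal (∑ a, ‖(Vᴴ *ᵥ g) a‖ ^ 2))⁻¹ := fun g => by
    have hcol : ∀ a i, (Vᴴ * (Matrix.of (j.insertNth g w.row))ᵀ) a i =
        (Vᴴ *ᵥ (j.insertNth g w.row : Fin (k + 1) → Fin s → 𝕜) i) a := fun a i => rfl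
    have h := inv_diag_mul_le_one (G := (Matrix.of (j.insertNth g w.row))ᵀ) hV (j := j)
      fun a i hi => by
        obtain ⟨i, rfl⟩ := Fin.exists_succAbove_eq hi
        rw [hcol, Fin.insertNth_apply_succAbove, hVw]
        rfl
    simp only [hcol, Fin.insertNth_apply_same] at h
    rw [ENNReal.le_inv_iff_mul_le, ← ENNReal.ofReal_mul' (by positivity)]
    exact ENNReal.ofReal_le_one.2 h
  refine (lintegral_mono hle).trans ?_
  have hmeas : Measurable fun h : Fin (s - k) → 𝕜 => (ENNReal.ofReal (∑ a, ‖h a‖ ^ 2))⁻¹ := by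
    have : Continuous fun h : Fin (s - k) → 𝕜 => ∑ a, ‖h a‖ ^ 2 := by fun_prop
    exact this.measurable.ennreal_ofReal.inv
  have hcast : ((s - k : ℕ) : ℝ) = s - k := Nat.cast_sub (by omega)
  have hs' : (k : ℝ) + 1 + fieldAlpha 𝕜 < s := by exact_mod_cast hs
  -- This uses (2 - α)(1 + α) = 2, true for α = 0 and α = 1.
  have hdim : realDim 𝕜 * ((s - k : ℕ) : ℝ) - 2 =
      realDim 𝕜 * (s - (k + 1) - fieldAlpha 𝕜) := by
    rw [hcast, realDim]
    rcases Nat.le_one_iff_eq_zero_or_eq_one.1 (fieldAlpha_le_one 𝕜) with h | h <;>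
      · rw [h]
        push_cast
        ring
  have hα : (fieldAlpha 𝕜 : ℝ) ≤ 1 := by exact_mod_cast fieldAlpha_le_one 𝕜
  have hpos : 0 < realDim 𝕜 * (s - (k + 1) - fieldAlpha 𝕜) :=
    mul_pos (by rw [realDim]; linarith) (by linarith)
  rw [(measurePreserving_isometry_mulVec hV).lintegral_comp hmeas,
    lintegral_inv_sum_sq (by linarith), hdim]

/-- The expected squared norm of the pseudoinverse of a Gaussian matrix. -/
theorem lintegral_norm_leftInv_sq_le (hs : k + fieldAlpha 𝕜 < s) :
    ∫⁻ G : Matrix (Fin s) (Fin k) 𝕜, ENNReal.ofReal (‖leftInv G‖ ^ 2) ∂(gaussianMatrix 𝕜 s k) ≤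
      ENNReal.ofReal (k / (realDim 𝕜 * (s - k - fieldAlpha 𝕜))) := by
  rcases k with _ | k
  · simp [norm_leftInv_sq]
  have hm : ∀ j, Measurable fun M : Matrix (Fin (k + 1)) (Fin s) 𝕜 =>
      ENNReal.ofReal (RCLike.re ((Mᵀᴴ * Mᵀ)⁻¹ j j)) := fun j =>
    (RCLike.continuous_re.measurable.comp ((measurable_matrix_transpose.matrix_conjTranspose.matrix_mul
      measurable_matrix_transpose).matrix_inv.matrix_elem j j)).ennreal_ofReal
  have hm' : Measurable fun G : Matrix (Fin s) (Fin (k + 1)) 𝕜 =>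
      ENNReal.ofReal (‖leftInv G‖ ^ 2) :=
    ((measurable_frobenius_norm.comp measurable_leftInv).pow_const 2).ennreal_ofReal
  rw [← (measurePreserving_transpose_gaussianMatrix (𝕜 := 𝕜) (d := k + 1) (N := s)).lintegral_comp
    hm']
  have e : ∀ M : Matrix (Fin (k + 1)) (Fin s) 𝕜, ENNReal.ofReal (‖leftInv Mᵀ‖ ^ 2) =
      ∑ j, ENNReal.ofReal (RCLike.re ((Mᵀᴴ * Mᵀ)⁻¹ j j)) := fun M => by
    rw [norm_leftInv_sq, ENNReal.ofReal_sum_of_nonneg]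
    intro j _
    rw [inv_diag_eq_sum, RCLike.ofReal_re]
    positivity
  simp only [e]
  rw [lintegral_finsetSum _ fun j _ => hm j]
  refine (Finset.sum_le_sum fun j _ => lintegral_inv_diag_le (by omega) j).trans ?_
  rw [Finset.sum_const, Finset.card_univ, Fintype.card_fin, ← ENNReal.ofReal_nsmul]
  refine ENNReal.ofReal_le_ofReal (le_of_eq ?_)
  push_cast
  rw [nsmul_eq_mul]
  push_cast
  ring

end InverseWishart

/-! ### Sketched regression and symmetrization by reflections -/

section Sketching

variable {𝕜 : Type*} [RCLike 𝕜] [MeasurableSpace 𝕜] [BorelSpace 𝕜]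

theorem realDim_pos (𝕜 : Type*) [RCLike 𝕜] : 0 < realDim 𝕜 := by
  have hα : (fieldAlpha 𝕜 : ℝ) ≤ 1 := by exact_mod_cast fieldAlpha_le_one 𝕜
  rw [realDim]
  linarith

theorem lintegral_norm_trace_mul_sq {d N : ℕ} (T : Matrix (Fin d) (Fin N) 𝕜) :
    ∫⁻ G : Matrix (Fin d) (Fin N) 𝕜, ENNReal.ofReal (‖(Tᴴ * G).trace‖ ^ 2)
      ∂(gaussianMatrix 𝕜 d N) = ENNReal.ofReal (realDim 𝕜 * ‖T‖ ^ 2) := by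
  have h : Measurable fun G : Matrix (Fin d) (Fin N) 𝕜 => (Tᴴ * G).trace :=
    Finset.measurable_fun_sum _ fun i _ =>
      ((measurable_const (a := Tᴴ)).matrix_mul measurable_id).matrix_elem i i
  have h' : Measurable fun x : 𝕜 => (‖T‖ : 𝕜) * x := measurable_const.mul measurable_id
  have hf : Measurable fun x : 𝕜 => ENNReal.ofReal (‖x‖ ^ 2) := by fun_prop
  rw [← lintegral_map (f := fun x : 𝕜 => ENNReal.ofReal (‖x‖ ^ 2)) hf h,
    map_trace_mul_gaussianMatrix, lintegral_map hf h']
  simp only [norm_mul, mul_pow, RCLike.norm_ofReal, abs_norm]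
  simp only [ENNReal.ofReal_mul (sq_nonneg ‖T‖)]
  rw [lintegral_const_mul _ hf, lintegral_norm_sq_stdNormal, mul_comm,
    ENNReal.ofReal_mul (realDim_pos 𝕜).le]

/-- Each entry of BGM is a linear functional of G, hence a scaled normal variable; the squared
scales sum to ‖B‖²‖M‖². -/
theorem lintegral_norm_mul_mul_sq {a d N b : ℕ} (B : Matrix (Fin a) (Fin d) 𝕜)
    (M : Matrix (Fin N) (Fin b) 𝕜) :
    ∫⁻ G : Matrix (Fin d) (Fin N) 𝕜, ENNReal.ofReal (‖B * G * M‖ ^ 2) ∂(gaussianMatrix 𝕜 d N) =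
      ENNReal.ofReal (realDim 𝕜 * ‖M‖ ^ 2) * ENNReal.ofReal (‖B‖ ^ 2) := by
  let T : Fin a → Fin b → Matrix (Fin d) (Fin N) 𝕜 := fun p q =>
    Matrix.of fun i j => star (B p i) * star (M j q)
  have hT : ∀ p q (G : Matrix (Fin d) (Fin N) 𝕜), (B * G * M) p q = ((T p q)ᴴ * G).trace := by
    intro p q G
    simp only [Matrix.trace, Matrix.diag, Matrix.mul_apply, T, Matrix.conjTranspose_apply,
      Matrix.of_apply, star_mul', star_star, Finset.sum_mul]
    exact Finset.sum_congr rfl fun j _ => Finset.sum_congr rfl fun i _ => by ring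
  have hnT : ∑ p, ∑ q, ‖T p q‖ ^ 2 = ‖M‖ ^ 2 * ‖B‖ ^ 2 := by
    simp only [frobenius_norm_sq, T, Matrix.of_apply, norm_mul, norm_star, mul_pow]
    simp only [← Finset.mul_sum]
    simp only [← Finset.sum_mul]
    simp only [← Finset.mul_sum]
    rw [Finset.sum_comm (f := fun q j => ‖M j q‖ ^ 2), mul_comm, Finset.sum_mul]
  have hm : ∀ p q, Measurable fun G : Matrix (Fin d) (Fin N) 𝕜 =>
      ENNReal.ofReal (‖((T p q)ᴴ * G).trace‖ ^ 2) := fun p q => by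
    have h : Measurable fun G : Matrix (Fin d) (Fin N) 𝕜 => ((T p q)ᴴ * G).trace :=
      Finset.measurable_fun_sum _ fun i _ =>
        ((measurable_const (a := (T p q)ᴴ)).matrix_mul measurable_id).matrix_elem i i
    exact (h.norm.pow_const 2).ennreal_ofReal
  have e : ∀ G : Matrix (Fin d) (Fin N) 𝕜, ENNReal.ofReal (‖B * G * M‖ ^ 2) =
      ∑ p, ∑ q, ENNReal.ofReal (‖((T p q)ᴴ * G).trace‖ ^ 2) := fun G => by
    rw [frobenius_norm_sq, ENNReal.ofReal_sum_of_nonneg fun _ _ => by positivity]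
    refine Finset.sum_congr rfl fun p _ => ?_
    rw [ENNReal.ofReal_sum_of_nonneg fun _ _ => by positivity]
    simp only [hT]
  simp only [e]
  rw [lintegral_finsetSum _ fun p _ => Finset.measurable_fun_sum _ fun q _ => hm p q]
  simp only [lintegral_finsetSum _ fun q _ => hm _ q, lintegral_norm_trace_mul_sq]
  have hβ := (realDim_pos 𝕜).le
  rw [← ENNReal.ofReal_mul (by positivity), mul_assoc, ← hnT, Finset.mul_sum,
    ENNReal.ofReal_sum_of_nonneg fun _ _ => by positivity]
  refine Finset.sum_congr rfl fun p _ => ?_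
  rw [Finset.mul_sum, ENNReal.ofReal_sum_of_nonneg fun _ _ => by positivity]

/-- The basic estimate for sketched regression: if `V` has orthonormal columns and `VᴴM = 0`, then
`𝔼 ‖(GV)† G M‖² ≤ p / (K - p - α) ‖M‖²`. -/
theorem lintegral_norm_leftInv_mul_mul_sq_le {K N p b : ℕ} (hK : p + fieldAlpha 𝕜 < K)
    {V : Matrix (Fin N) (Fin p) 𝕜} (hV : Vᴴ * V = 1) {M : Matrix (Fin N) (Fin b) 𝕜}
    (hM : Vᴴ * M = 0) :
    ∫⁻ G : Matrix (Fin K) (Fin N) 𝕜, ENNReal.ofReal (‖leftInv (G * V) * G * M‖ ^ 2)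
        ∂(gaussianMatrix 𝕜 K N) ≤
      ENNReal.ofReal (p / (K - p - fieldAlpha 𝕜) * ‖M‖ ^ 2) := by
  have hf : Measurable fun G : Matrix (Fin K) (Fin N) 𝕜 =>
      ENNReal.ofReal (‖leftInv (G * V) * G * M‖ ^ 2) :=
    ((measurable_frobenius_norm.comp (((measurable_leftInv.comp
      (measurable_id.matrix_mul measurable_const)).matrix_mul measurable_id).matrix_mul
        measurable_const)).pow_const 2).ennreal_ofReal
  have hproj := IsOrthProj.of_isometry hV
  have h0 : V * Vᴴ * M = 0 := by rw [Matrix.mul_assoc, hM, Matrix.mul_zero]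
  have h1 : V * Vᴴ * V = V := by rw [Matrix.mul_assoc, hV, Matrix.mul_one]
  -- GV and GM see complementary components of G, so the second may be replaced by an independent
  -- copy. Then the integrals over the copy and over GV separate, and the factor `realDim 𝕜` of the
  -- former cancels that of the inverse moment.
  rw [← (measurePreserving_resample hproj).lintegral_comp hf]
  have e : ∀ G : Matrix (Fin K) (Fin N) 𝕜 × Matrix (Fin K) (Fin N) 𝕜,
      leftInv ((G.1 * (V * Vᴴ) + G.2 * (1 - V * Vᴴ)) * V) *
        (G.1 * (V * Vᴴ) + G.2 * (1 - V * Vᴴ)) * M = leftInv (G.1 * V) * G.2 * M := fun G => by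
    have e1 : (G.1 * (V * Vᴴ) + G.2 * (1 - V * Vᴴ)) * V = G.1 * V := by
      rw [Matrix.add_mul, Matrix.mul_assoc, h1, Matrix.mul_assoc, Matrix.sub_mul, h1,
        Matrix.one_mul, sub_self, Matrix.mul_zero, add_zero]
    have e2 : (G.1 * (V * Vᴴ) + G.2 * (1 - V * Vᴴ)) * M = G.2 * M := by
      rw [Matrix.add_mul, Matrix.mul_assoc, h0, Matrix.mul_assoc, Matrix.sub_mul, h0,
        Matrix.one_mul, sub_zero, Matrix.mul_zero, zero_add]
    rw [e1, Matrix.mul_assoc, e2, Matrix.mul_assoc]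
  simp only [e]
  refine (lintegral_prod_le _).trans ?_
  simp only [lintegral_norm_mul_mul_sq]
  have hg : Measurable fun G : Matrix (Fin K) (Fin p) 𝕜 => ENNReal.ofReal (‖leftInv G‖ ^ 2) :=
    ((measurable_frobenius_norm.comp measurable_leftInv).pow_const 2).ennreal_ofReal
  rw [lintegral_const_mul' _ _ ENNReal.ofReal_ne_top,
    (measurePreserving_mul_isometry hV).lintegral_comp hg]
  refine (mul_le_mul_right (lintegral_norm_leftInv_sq_le hK) _).trans ?_
  have hβ := realDim_pos 𝕜
  have hK' : (p : ℝ) + fieldAlpha 𝕜 < K := by exact_mod_cast hK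
  rw [← ENNReal.ofReal_mul (by positivity)]
  refine ENNReal.ofReal_le_ofReal (le_of_eq ?_)
  have : (K : ℝ) - p - fieldAlpha 𝕜 ≠ 0 := by linarith
  field_simp

/-- Averaging a function over an involution that preserves the measure. -/
theorem lintegral_le_of_average {X : Type*} [MeasurableSpace X] {μ : Measure X} {φ : X → X}
    (hφ : MeasurePreserving φ μ μ) (hinv : Function.Involutive φ) {f g : X → ENNReal}
    (h : ∀ x, f x + f (φ x) ≤ 2 * g x) : ∫⁻ x, f x ∂μ ≤ ∫⁻ x, g x ∂μ := by
  have h1 : ∫⁻ x, f (φ x) ∂μ = ∫⁻ x, f x ∂μ :=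
    -- No measurability of f is required: φ is a measurable equivalence, and the lower integral is
    -- superadditive. This matters for integrands built from pseudoinverses or from their range
    -- projections.
    hφ.lintegral_comp_emb (MeasurableEquiv.ofInvolutive φ hinv hφ.measurable).measurableEmbedding f
  have h2 : 2 * ∫⁻ x, f x ∂μ ≤ 2 * ∫⁻ x, g x ∂μ := by
    rw [two_mul]
    nth_rewrite 2 [← h1]
    rw [← lintegral_const_mul' _ _ (by simp)]
    exact (le_lintegral_add _ _).trans (lintegral_mono h)
  exact (ENNReal.mul_le_mul_iff_right (by simp) (by simp)).1 h2

theorem measurePreserving_mul_reflection {K N : ℕ} {P : Matrix (Fin N) (Fin N) 𝕜}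
    (hP : IsOrthProj P) :
    MeasurePreserving (fun G : Matrix (Fin K) (Fin N) 𝕜 => G * (1 - (2 : 𝕜) • P))
      (gaussianMatrix 𝕜 K N) (gaussianMatrix 𝕜 K N) :=
  measurePreserving_mul_isometry (by rw [hP.reflection_hermitian, hP.reflection_mul_self])

omit [MeasurableSpace 𝕜] [BorelSpace 𝕜] in
theorem involutive_mul_reflection {K N : ℕ} {P : Matrix (Fin N) (Fin N) 𝕜} (hP : IsOrthProj P) :
    Function.Involutive fun G : Matrix (Fin K) (Fin N) 𝕜 => G * (1 - (2 : 𝕜) • P) := fun G => by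
  simp only [Matrix.mul_assoc, hP.reflection_mul_self, Matrix.mul_one]

omit [MeasurableSpace 𝕜] [BorelSpace 𝕜] in
theorem leftInv_neg {I J : Type*} [Fintype I] [Fintype J] [DecidableEq J] (G : Matrix I J 𝕜) :
    leftInv (-G) = -leftInv G := by
  simp [leftInv]

/-- The component of `(GV)† G` that is orthogonal to the columns of `V`. -/
noncomputable def sketchError {K N p : ℕ} (V : Matrix (Fin N) (Fin p) 𝕜)
    (G : Matrix (Fin K) (Fin N) 𝕜) : Matrix (Fin p) (Fin N) 𝕜 :=
  leftInv (G * V) * G * (1 - V * Vᴴ)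

section SketchError

variable {K N p : ℕ} {V : Matrix (Fin N) (Fin p) 𝕜}

omit [MeasurableSpace 𝕜] [BorelSpace 𝕜] in
theorem leftInv_mul_eq_add_sketchError {G : Matrix (Fin K) (Fin N) 𝕜}
    (hG : IsUnit ((G * V)ᴴ * (G * V)).det) :
    leftInv (G * V) * G = Vᴴ + sketchError V G := by
  have h : leftInv (G * V) * G * (V * Vᴴ) = Vᴴ := by
    rw [Matrix.mul_assoc, ← Matrix.mul_assoc G, ← Matrix.mul_assoc, leftInv_mul hG, Matrix.one_mul]
  rw [sketchError, Matrix.mul_sub, h, Matrix.mul_one]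
  abel

-- The reflection sends GV to -GV and fixes G(1 - VVᴴ), so exactly one sign survives.
omit [MeasurableSpace 𝕜] [BorelSpace 𝕜] in
theorem sketchError_mul_reflection (hV : Vᴴ * V = 1) (G : Matrix (Fin K) (Fin N) 𝕜) :
    sketchError V (G * (1 - (2 : 𝕜) • (V * Vᴴ))) = -sketchError V G := by
  have h1 : V * Vᴴ * V = V := by rw [Matrix.mul_assoc, hV, Matrix.mul_one]
  have hproj := IsOrthProj.of_isometry hV
  have e1 : (1 - (2 : 𝕜) • (V * Vᴴ)) * V = -V := by
    rw [Matrix.sub_mul, Matrix.smul_mul, h1, Matrix.one_mul]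
    module
  have e2 : (1 - (2 : 𝕜) • (V * Vᴴ)) * (1 - V * Vᴴ) = 1 - V * Vᴴ := by
    rw [Matrix.sub_mul, Matrix.smul_mul, hproj.mul_compl, Matrix.one_mul, smul_zero, sub_zero]
  rw [sketchError, Matrix.mul_assoc G, e1, Matrix.mul_neg, leftInv_neg, Matrix.mul_assoc,
    Matrix.mul_assoc G, e2, sketchError, Matrix.mul_assoc, Matrix.neg_mul]

theorem measurable_sketchError :
    Measurable (sketchError V : Matrix (Fin K) (Fin N) 𝕜 → Matrix (Fin p) (Fin N) 𝕜) :=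
  ((measurable_leftInv.comp (measurable_id.matrix_mul measurable_const)).matrix_mul
    measurable_id).matrix_mul measurable_const

theorem lintegral_norm_sketchError_mul_sq_le (hK : p + fieldAlpha 𝕜 < K) (hV : Vᴴ * V = 1) {b : ℕ}
    (M : Matrix (Fin N) (Fin b) 𝕜) :
    ∫⁻ G : Matrix (Fin K) (Fin N) 𝕜, ENNReal.ofReal (‖sketchError V G * M‖ ^ 2)
        ∂(gaussianMatrix 𝕜 K N) ≤
      ENNReal.ofReal (p / (K - p - fieldAlpha 𝕜) * ‖(1 - V * Vᴴ) * M‖ ^ 2) := by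
  simp only [sketchError, Matrix.mul_assoc _ (1 - V * Vᴴ)]
  refine lintegral_norm_leftInv_mul_mul_sq_le hK hV ?_
  rw [← Matrix.mul_assoc, Matrix.mul_sub, ← Matrix.mul_assoc, hV, Matrix.mul_one, Matrix.one_mul,
    sub_self, Matrix.zero_mul]

/-- The sketching error and its negative have the same law, so the cross term with the fixed matrix
B averages out by the parallelogram identity. -/
theorem lintegral_norm_add_sketchError_mul_sq_le (hK : p + fieldAlpha 𝕜 < K) (hV : Vᴴ * V = 1)
    {b : ℕ} (M : Matrix (Fin N) (Fin b) 𝕜) (B : Matrix (Fin p) (Fin b) 𝕜) :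
    ∫⁻ G : Matrix (Fin K) (Fin N) 𝕜, ENNReal.ofReal (‖B + sketchError V G * M‖ ^ 2)
        ∂(gaussianMatrix 𝕜 K N) ≤
      ENNReal.ofReal (‖B‖ ^ 2 + p / (K - p - fieldAlpha 𝕜) * ‖(1 - V * Vᴴ) * M‖ ^ 2) := by
  have hK' : (p : ℝ) + fieldAlpha 𝕜 < K := by exact_mod_cast hK
  have hproj := IsOrthProj.of_isometry hV
  refine (lintegral_le_of_average (measurePreserving_mul_reflection hproj)
    (involutive_mul_reflection hproj) (g := fun G => ENNReal.ofReal (‖B‖ ^ 2) +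
      ENNReal.ofReal (‖sketchError V G * M‖ ^ 2)) fun G => le_of_eq ?_).trans ?_
  · rw [sketchError_mul_reflection hV, Matrix.neg_mul, ← sub_eq_add_neg,
      ← ENNReal.ofReal_add (by positivity) (by positivity), frobenius_parallelogram,
      ENNReal.ofReal_mul zero_le_two, ENNReal.ofReal_add (by positivity) (by positivity)]
    simp
  · rw [lintegral_add_left measurable_const, ENNReal.ofReal_add (by positivity)
      (mul_nonneg (div_nonneg (by positivity) (by linarith)) (by positivity))]
    simp only [lintegral_const, measure_univ, mul_one]
    exact add_le_add_right (lintegral_norm_sketchError_mul_sq_le hK hV M) _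

end SketchError

end Sketching

/-! ### Error of the core approximation for fixed bases -/

section CoreError

variable {𝕜 : Type*} [RCLike 𝕜] {m n k s : ℕ}

/-- The core approximation with left inverses in place of pseudoinverses. -/
noncomputable def leftInvCore (A : Matrix (Fin m) (Fin n) 𝕜) (Φ : Matrix (Fin s) (Fin m) 𝕜)
    (Ψ : Matrix (Fin s) (Fin n) 𝕜) (Q : Matrix (Fin m) (Fin k) 𝕜) (P : Matrix (Fin n) (Fin k) 𝕜) :
    Matrix (Fin k) (Fin k) 𝕜 :=
  leftInv (Φ * Q) * (Φ * A * Ψᴴ) * (leftInv (Ψ * P))ᴴ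

/-- The residual consists of the three orthogonal blocks of A other than the (Q, P) block. The core
error is later estimated block by block against them. -/
theorem norm_sq_sub_compress (A : Matrix (Fin m) (Fin n) 𝕜) {Q : Matrix (Fin m) (Fin k) 𝕜}
    {P : Matrix (Fin n) (Fin k) 𝕜} (hQ : Qᴴ * Q = 1) (hP : Pᴴ * P = 1) :
    ‖A - Q * (Qᴴ * A * P) * Pᴴ‖ ^ 2 =
      ‖(1 - Q * Qᴴ) * A * P‖ ^ 2 + ‖Qᴴ * A * (1 - P * Pᴴ)‖ ^ 2 +
        ‖(1 - Q * Qᴴ) * A * (1 - P * Pᴴ)‖ ^ 2 := by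
  have hq := IsOrthProj.of_isometry hQ
  have hp := IsOrthProj.of_isometry hP
  have e : Q * (Qᴴ * A * P) * Pᴴ = Q * Qᴴ * A * (P * Pᴴ) := by simp only [Matrix.mul_assoc]
  have e1 : Q * Qᴴ * (A - Q * Qᴴ * A * (P * Pᴴ)) = Q * (Qᴴ * A * (1 - P * Pᴴ)) := by
    rw [Matrix.mul_sub, Matrix.mul_assoc (Q * Qᴴ) A, ← Matrix.mul_assoc (Q * Qᴴ) (Q * Qᴴ), hq.idem,
      ← Matrix.mul_sub, Matrix.mul_assoc, Matrix.mul_assoc, Matrix.mul_sub A, Matrix.mul_one]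
  have e2 : (1 - Q * Qᴴ) * (A - Q * Qᴴ * A * (P * Pᴴ)) = (1 - Q * Qᴴ) * A := by
    rw [Matrix.mul_sub, Matrix.mul_assoc (Q * Qᴴ) A, ← Matrix.mul_assoc (1 - Q * Qᴴ) (Q * Qᴴ),
      hq.compl_mul, Matrix.zero_mul, sub_zero]
  rw [e, hq.norm_sq_left, e1, e2, frobenius_norm_isometry_mul hQ,
    hp.norm_sq_right ((1 - Q * Qᴴ) * A), ← Matrix.mul_assoc _ P, frobenius_norm_mul_isometry hP]
  ring

/-- The last term is the adjoint of C - Q*AP, arranged for fixed Φ as a constant plus the error of Ψ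
applied to a constant matrix, the form to which `lintegral_norm_add_sketchError_mul_sq_le` applies.
-/
theorem norm_sq_sub_leftInvCore {A : Matrix (Fin m) (Fin n) 𝕜} {Φ : Matrix (Fin s) (Fin m) 𝕜}
    {Ψ : Matrix (Fin s) (Fin n) 𝕜} {Q : Matrix (Fin m) (Fin k) 𝕜} {P : Matrix (Fin n) (Fin k) 𝕜}
    (hQ : Qᴴ * Q = 1) (hP : Pᴴ * P = 1) (hΦ : IsUnit ((Φ * Q)ᴴ * (Φ * Q)).det)
    (hΨ : IsUnit ((Ψ * P)ᴴ * (Ψ * P)).det) :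
    ‖A - Q * leftInvCore A Φ Ψ Q P * Pᴴ‖ ^ 2 =
      ‖A - Q * (Qᴴ * A * P) * Pᴴ‖ ^ 2 +
        ‖(sketchError Q Φ * (A * P))ᴴ +
          sketchError P Ψ * (Aᴴ * (Q + (sketchError Q Φ)ᴴ))‖ ^ 2 := by
  rw [norm_sub_rev, norm_sq_compress_sub hQ hP, add_comm]
  congr 2
  rw [← Matrix.frobenius_norm_conjTranspose]
  congr 1
  have h1 : leftInvCore A Φ Ψ Q P = (Qᴴ + sketchError Q Φ) * A * (Pᴴ + sketchError P Ψ)ᴴ := by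
    rw [← leftInv_mul_eq_add_sketchError hΦ, ← leftInv_mul_eq_add_sketchError hΨ, leftInvCore,
      Matrix.conjTranspose_mul]
    simp only [Matrix.mul_assoc]
  rw [h1]
  simp only [Matrix.conjTranspose_sub, Matrix.conjTranspose_add, Matrix.conjTranspose_mul,
    Matrix.conjTranspose_conjTranspose, Matrix.add_mul, Matrix.mul_add, Matrix.mul_assoc]
  abel

variable [MeasurableSpace 𝕜] [BorelSpace 𝕜]

theorem ae_isUnit_det_mul_isometry (hks : k ≤ s) {Q : Matrix (Fin m) (Fin k) 𝕜}
    (hQ : Qᴴ * Q = 1) :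
    ∀ᵐ Φ : Matrix (Fin s) (Fin m) 𝕜 ∂(gaussianMatrix 𝕜 s m),
      IsUnit ((Φ * Q)ᴴ * (Φ * Q)).det :=
  (measurePreserving_mul_isometry hQ).quasiMeasurePreserving.ae (ae_isUnit_det_gaussianMatrix hks)

/-- The expected error of the core approximation for fixed range and corange bases. -/
theorem lintegral_norm_sub_leftInvCore_sq_le (A : Matrix (Fin m) (Fin n) 𝕜) (hk : 0 < k)
    (hs : 2 * k + fieldAlpha 𝕜 ≤ s) {Q : Matrix (Fin m) (Fin k) 𝕜} {P : Matrix (Fin n) (Fin k) 𝕜}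
    (hQ : Qᴴ * Q = 1) (hP : Pᴴ * P = 1) :
    ∫⁻ z : Matrix (Fin s) (Fin m) 𝕜 × Matrix (Fin s) (Fin n) 𝕜,
        ENNReal.ofReal (‖A - Q * leftInvCore A z.1 z.2 Q P * Pᴴ‖ ^ 2)
          ∂((gaussianMatrix 𝕜 s m).prod (gaussianMatrix 𝕜 s n)) ≤
      ENNReal.ofReal ((s - fieldAlpha 𝕜) / (s - k - fieldAlpha 𝕜) *
        ‖A - Q * (Qᴴ * A * P) * Pᴴ‖ ^ 2) := by
  have hks : k + fieldAlpha 𝕜 < s := by omega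
  have hs' : 2 * (k : ℝ) + fieldAlpha 𝕜 ≤ s := by exact_mod_cast hs
  have hk' : (0 : ℝ) < k := by exact_mod_cast hk
  set c : ℝ := k / (s - k - fieldAlpha 𝕜) with hc
  have hc0 : 0 ≤ c := div_nonneg hk'.le (by linarith)
  -- This is where s ≥ 2k + α enters: the doubly sketched block contributes c², which c ≤ 1 absorbs
  -- into c.
  have hc1 : c ≤ 1 := (div_le_one (by linarith)).2 (by linarith)
  set D : ℝ := ‖A - Q * (Qᴴ * A * P) * Pᴴ‖ ^ 2 with hD
  have hD0 : 0 ≤ D := sq_nonneg _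
  have hDeq := norm_sq_sub_compress A hQ hP
  rw [← hD] at hDeq
  set E : Matrix (Fin s) (Fin m) 𝕜 → Matrix (Fin k) (Fin m) 𝕜 := sketchError Q with hE
  have inner : ∀ᵐ Φ : Matrix (Fin s) (Fin m) 𝕜 ∂(gaussianMatrix 𝕜 s m),
      ∫⁻ Ψ : Matrix (Fin s) (Fin n) 𝕜,
        ENNReal.ofReal (‖A - Q * leftInvCore A Φ Ψ Q P * Pᴴ‖ ^ 2) ∂(gaussianMatrix 𝕜 s n) ≤
      ENNReal.ofReal D + (ENNReal.ofReal (‖E Φ * (A * P)‖ ^ 2) + ENNReal.ofReal c *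
        ENNReal.ofReal (‖Qᴴ * A * (1 - P * Pᴴ) + E Φ * (A * (1 - P * Pᴴ))‖ ^ 2)) := by
    filter_upwards [ae_isUnit_det_mul_isometry (by omega) hQ] with Φ hΦ
    have h1 : ∀ᵐ Ψ : Matrix (Fin s) (Fin n) 𝕜 ∂(gaussianMatrix 𝕜 s n),
        ENNReal.ofReal (‖A - Q * leftInvCore A Φ Ψ Q P * Pᴴ‖ ^ 2) = ENNReal.ofReal D +
          ENNReal.ofReal (‖(E Φ * (A * P))ᴴ + sketchError P Ψ * (Aᴴ * (Q + (E Φ)ᴴ))‖ ^ 2) := by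
      filter_upwards [ae_isUnit_det_mul_isometry (by omega) hP] with Ψ hΨ
      rw [norm_sq_sub_leftInvCore hQ hP hΦ hΨ, ENNReal.ofReal_add hD0 (sq_nonneg _)]
    rw [lintegral_congr_ae h1, lintegral_add_left measurable_const, lintegral_const,
      measure_univ, mul_one]
    refine add_le_add_right ?_ _
    refine (lintegral_norm_add_sketchError_mul_sq_le hks hP _ _).trans (le_of_eq ?_)
    rw [Matrix.frobenius_norm_conjTranspose, ← hc, ENNReal.ofReal_add (sq_nonneg _) (by positivity),
      ENNReal.ofReal_mul hc0]
    congr 4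
    rw [← Matrix.frobenius_norm_conjTranspose]
    congr 1
    simp only [Matrix.conjTranspose_mul, Matrix.conjTranspose_add, Matrix.conjTranspose_conjTranspose,
      (IsOrthProj.of_isometry hP).compl.hermitian, Matrix.add_mul, Matrix.mul_assoc]
  refine (lintegral_prod_le _).trans ((lintegral_mono_ae inner).trans ?_)
  have hm : Measurable fun Φ => ENNReal.ofReal (‖E Φ * (A * P)‖ ^ 2) :=
    ((measurable_frobenius_norm.comp (measurable_sketchError.matrix_mul
      measurable_const)).pow_const 2).ennreal_ofReal
  rw [lintegral_add_left measurable_const, lintegral_const, measure_univ, mul_one,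
    lintegral_add_left hm, lintegral_const_mul' _ _ ENNReal.ofReal_ne_top]
  have b1 := lintegral_norm_sketchError_mul_sq_le hks hQ (A * P)
  have b2 := lintegral_norm_add_sketchError_mul_sq_le hks hQ (A * (1 - P * Pᴴ))
    (Qᴴ * A * (1 - P * Pᴴ))
  rw [← hc, ← Matrix.mul_assoc] at b1 b2
  refine (add_le_add_right (add_le_add b1 (mul_le_mul_right b2 _)) _).trans ?_
  set x := ‖(1 - Q * Qᴴ) * A * P‖ ^ 2
  set y := ‖Qᴴ * A * (1 - P * Pᴴ)‖ ^ 2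
  set z := ‖(1 - Q * Qᴴ) * A * (1 - P * Pᴴ)‖ ^ 2
  have hx : 0 ≤ x := sq_nonneg _
  have hy : 0 ≤ y := sq_nonneg _
  have hz : 0 ≤ z := sq_nonneg _
  rw [← ENNReal.ofReal_mul hc0, ← ENNReal.ofReal_add (by positivity) (by positivity),
    ← ENNReal.ofReal_add (by positivity) (by positivity)]
  refine ENNReal.ofReal_le_ofReal ?_
  have hsc : ((s : ℝ) - fieldAlpha 𝕜) / (s - k - fieldAlpha 𝕜) = 1 + c := by
    rw [hc]
    have : (s : ℝ) - k - fieldAlpha 𝕜 ≠ 0 := by linarith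
    field_simp
    ring
  rw [hsc, hDeq]
  have : c * (c * z) ≤ c * z := mul_le_mul_of_nonneg_left (by nlinarith) hc0
  nlinarith

end CoreError

/-! ### Singular bases and the Eckart–Young theorem -/

section EckartYoung

variable {𝕜 : Type*} [RCLike 𝕜] {m n : ℕ}

/-- An orthonormal basis of the column space of a matrix. -/
theorem exists_isometry_range (Y : Matrix (Fin m) (Fin n) 𝕜) :
    ∃ (U : Matrix (Fin m) (Fin Y.rank) 𝕜) (X : Matrix (Fin n) (Fin Y.rank) 𝕜),
      Uᴴ * U = 1 ∧ U * Uᴴ * Y = Y ∧ U = Y * X := by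
  let c : Fin n → EuclideanSpace 𝕜 (Fin m) := fun j => WithLp.toLp 2 (Y.col j)
  let W : Submodule 𝕜 (EuclideanSpace 𝕜 (Fin m)) := Submodule.span 𝕜 (Set.range c)
  have hW : Module.finrank 𝕜 W = Y.rank := by
    let e : (Fin m → 𝕜) ≃ₗ[𝕜] EuclideanSpace 𝕜 (Fin m) := (WithLp.linearEquiv 2 𝕜 (Fin m → 𝕜)).symm
    have h1 : W = (Submodule.span 𝕜 (Set.range Y.col)).map (e : (Fin m → 𝕜) →ₗ[𝕜] _) := by
      rw [Submodule.map_span, ← Set.range_comp]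
      rfl
    rw [Matrix.rank_eq_finrank_span_cols, h1]
    exact LinearEquiv.finrank_map_eq e _
  let b : OrthonormalBasis (Fin Y.rank) 𝕜 W := (stdOrthonormalBasis 𝕜 W).reindex (finCongr hW)
  have hb : Orthonormal 𝕜 fun a => (b a : EuclideanSpace 𝕜 (Fin m)) :=
    b.orthonormal.comp_linearIsometry W.subtypeₗᵢ
  have hX : ∀ a, ∃ x : Fin n → 𝕜, ∑ j, x j • c j = b a := fun a =>
    (Submodule.mem_span_range_iff_exists_fun 𝕜).1 (b a).2
  choose x hx using hX
  refine ⟨Matrix.of fun i a => (b a : EuclideanSpace 𝕜 (Fin m)) i, Matrix.of fun j a => x a j,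
    ?_, ?_, ?_⟩
  · ext a d
    have := orthonormal_iff_ite.1 hb a d
    rw [EuclideanSpace.inner_eq_star_dotProduct] at this
    rw [Matrix.one_apply, ← this]
    simp [Matrix.mul_apply, dotProduct, mul_comm]
  · ext i j
    have hc : c j ∈ W := Submodule.subset_span ⟨j, rfl⟩
    have h := congrArg (fun w : W => (w : EuclideanSpace 𝕜 (Fin m)) i) (b.sum_repr' ⟨c j, hc⟩)
    simp only [Submodule.coe_inner, EuclideanSpace.inner_eq_star_dotProduct] at h
    rw [Matrix.mul_assoc, Matrix.mul_apply]
    refine Eq.trans ?_ h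
    simp [Matrix.mul_apply, dotProduct, mul_comm, c]
  · ext i a
    have := congrArg (fun w : EuclideanSpace 𝕜 (Fin m) => w i) (hx a)
    simp only [Matrix.of_apply, Matrix.mul_apply, ← this]
    simp [c, mul_comm]

/-- A right singular basis with decreasing squared singular values. -/
theorem exists_right_singular_basis (A : Matrix (Fin m) (Fin n) 𝕜) :
    ∃ (W : Matrix (Fin n) (Fin n) 𝕜) (l : Fin n → ℝ), Antitone l ∧ (∀ i, 0 ≤ l i) ∧ Wᴴ * W = 1 ∧
      (A * W)ᴴ * (A * W) = Matrix.diagonal fun i => (l i : 𝕜) := by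
  have hH : (Aᴴ * A).IsHermitian := Matrix.isHermitian_conjTranspose_mul_self A
  let σ : Fin n ≃ Fin n := (finCongr (Fintype.card_fin n).symm).trans
    (Fintype.equivOfCardEq (Fintype.card_fin _))
  let U : Matrix (Fin n) (Fin n) 𝕜 := hH.eigenvectorUnitary.1
  have hUU : Uᴴ * U = 1 := by
    simpa [U, Matrix.star_eq_conjTranspose] using
      (Matrix.mem_unitaryGroup_iff'.1 hH.eigenvectorUnitary.2)
  have hspec : Aᴴ * A = U * Matrix.diagonal (fun i => (hH.eigenvalues i : 𝕜)) * Uᴴ := by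
    have h := hH.spectral_theorem
    rw [Unitary.conjStarAlgAut_apply] at h
    exact h
  have hWW : (U.submatrix id σ)ᴴ * U.submatrix id σ = 1 := by
    rw [Matrix.conjTranspose_submatrix, ← Matrix.submatrix_mul _ _ _ _ _ Function.bijective_id, hUU]
    simp
  have hdiag : (A * U.submatrix id σ)ᴴ * (A * U.submatrix id σ) =
      Matrix.diagonal fun i => (hH.eigenvalues (σ i) : 𝕜) := by
    have e : (A * U.submatrix id σ)ᴴ * (A * U.submatrix id σ) = (Uᴴ * (Aᴴ * A) * U).submatrix σ σ := by
      ext i j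
      simp only [Matrix.conjTranspose_mul, Matrix.mul_assoc]
      rfl
    have e2 : Uᴴ * (Aᴴ * A) * U = Matrix.diagonal fun i => (hH.eigenvalues i : 𝕜) := by
      refine (congrArg (fun M => Uᴴ * M * U) hspec).trans ?_
      rw [Matrix.mul_assoc U, ← Matrix.mul_assoc Uᴴ U, hUU, Matrix.one_mul, Matrix.mul_assoc,
        hUU, Matrix.mul_one]
    rw [e, e2, Matrix.submatrix_diagonal_equiv]
    rfl
  refine ⟨U.submatrix id σ, fun i => hH.eigenvalues (σ i), ?_, fun i => ?_, hWW, hdiag⟩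
  · intro i j hij
    have : ∀ i, hH.eigenvalues (σ i) = hH.eigenvalues₀ (finCongr (Fintype.card_fin n).symm i) :=
      fun i => by simp [Matrix.IsHermitian.eigenvalues, σ]
    simp only [this]
    exact hH.eigenvalues₀_antitone (by simpa using hij)
  · have h := congrFun (congrFun hdiag i) i
    rw [Matrix.diagonal_apply_eq, Matrix.mul_apply] at h
    simp only [Matrix.conjTranspose_apply, RCLike.star_def, RCLike.conj_mul] at h
    have h' : (hH.eigenvalues (σ i) : ℝ) = ∑ a, ‖(A * U.submatrix id σ) a i‖ ^ 2 := by
      exact_mod_cast h.symm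
    have h0 : 0 ≤ hH.eigenvalues (σ i) := by
      rw [h']
      positivity
    exact h0

/-- Expresses the captured energy as a weighted sum of squared singular values, the weights being
the squared row norms of R. -/
theorem norm_mul_sq_of_gram_diagonal {k : ℕ} {M : Matrix (Fin m) (Fin n) 𝕜} {l : Fin n → ℝ}
    (hM : Mᴴ * M = Matrix.diagonal fun i => (l i : 𝕜)) (R : Matrix (Fin n) (Fin k) 𝕜) :
    ‖M * R‖ ^ 2 = ∑ i, l i * ∑ a, ‖R i a‖ ^ 2 := by
  rw [frobenius_norm_sq_eq_trace, Matrix.conjTranspose_mul, Matrix.mul_assoc, ← Matrix.mul_assoc Mᴴ,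
    hM, Matrix.trace_mul_comm, Matrix.trace, map_sum]
  refine Finset.sum_congr rfl fun i _ => ?_
  rw [Matrix.diag_apply, Matrix.mul_assoc, Matrix.diagonal_mul, RCLike.re_ofReal_mul, Matrix.mul_apply,
    map_sum]
  congr 1
  refine Finset.sum_congr rfl fun a _ => ?_
  rw [Matrix.conjTranspose_apply, RCLike.star_def, RCLike.mul_conj]
  norm_cast

/-- RRᴴ is an orthogonal projection, so R contracts the i-th unit row vector. -/
theorem sum_row_sq_le_one {k : ℕ} {R : Matrix (Fin n) (Fin k) 𝕜} (hR : Rᴴ * R = 1) (i : Fin n) :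
    ∑ a, ‖R i a‖ ^ 2 ≤ 1 := by
  let e : Matrix Unit (Fin n) 𝕜 := Matrix.of fun _ => Pi.single i 1
  have h1 : ‖e * R‖ ≤ ‖e‖ := by
    rw [← frobenius_norm_mul_isometry hR, Matrix.mul_assoc]
    exact (IsOrthProj.of_isometry hR).norm_mul_le' e
  have h2 := pow_le_pow_left₀ (norm_nonneg _) h1 2
  rw [frobenius_norm_sq, frobenius_norm_sq] at h2
  simpa [e, Matrix.mul_apply, Pi.single_apply, apply_ite, ite_pow] using h2

theorem sum_row_sq {k : ℕ} {R : Matrix (Fin n) (Fin k) 𝕜} (hR : Rᴴ * R = 1) :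
    ∑ i, ∑ a, ‖R i a‖ ^ 2 = k := by
  rw [← frobenius_norm_sq, frobenius_norm_sq_eq_trace, hR, Matrix.trace_one]
  simp

open scoped ComplexOrder in
/-- The Eckart–Young theorem: projecting onto leading right singular vectors gives a best
approximation of rank `r`, and this projection is also a projection from the left. -/
theorem exists_singular_projections (A : Matrix (Fin m) (Fin n) 𝕜) {r : ℕ} (hr : r ≤ n) :
    ∃ (d : ℕ) (U : Matrix (Fin m) (Fin d) 𝕜) (V : Matrix (Fin n) (Fin r) 𝕜), d ≤ r ∧ Uᴴ * U = 1 ∧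
      Vᴴ * V = 1 ∧ U * Uᴴ * A = A * (V * Vᴴ) ∧
      ∀ B : Matrix (Fin m) (Fin n) 𝕜, B.rank ≤ r → ‖A * (1 - V * Vᴴ)‖ ≤ ‖A - B‖ := by
  obtain ⟨W, l, hl, hl0, hW, hAW⟩ := exists_right_singular_basis A
  have hW' : W * Wᴴ = 1 := mul_eq_one_comm.1 hW
  let R₀ : Matrix (Fin n) (Fin r) 𝕜 := (1 : Matrix (Fin n) (Fin n) 𝕜).submatrix id (Fin.castLE hr)
  have hR₀ : R₀ᴴ * R₀ = 1 := by
    have : R₀ᴴ * R₀ = ((1 : Matrix (Fin n) (Fin n) 𝕜)ᴴ * 1).submatrix (Fin.castLE hr) (Fin.castLE hr) :=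
      rfl
    rw [this, Matrix.conjTranspose_one, Matrix.one_mul,
      Matrix.submatrix_one _ (Fin.castLE_injective hr)]
  let V := W * R₀
  have hV : Vᴴ * V = 1 := by
    rw [Matrix.conjTranspose_mul, Matrix.mul_assoc, ← Matrix.mul_assoc Wᴴ, hW, Matrix.one_mul, hR₀]
  have hVproj := IsOrthProj.of_isometry hV
  obtain ⟨U, X, hU, hUY, hUX⟩ := exists_isometry_range (A * V)
  refine ⟨(A * V).rank, U, V, (Matrix.rank_le_width _), hU, hV, ?_, fun B hB => ?_⟩
  · have h1 : U * Uᴴ * A * (V * Vᴴ) = A * (V * Vᴴ) := by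
      rw [← Matrix.mul_assoc, Matrix.mul_assoc _ A, hUY, Matrix.mul_assoc]
    -- As U = AVX, the product is Xᴴ(VᴴAᴴA)(1 - VVᴴ); the rows of Vᴴ are left eigenvectors of AᴴA,
    -- so the middle factor is a diagonal matrix times Vᴴ, which 1 - VVᴴ kills.
    have h2 : Uᴴ * A * (1 - V * Vᴴ) = 0 := by
      have e1 : Vᴴ * Aᴴ * A = R₀ᴴ * (Matrix.diagonal fun i => (l i : 𝕜)) * Wᴴ := by
        rw [← hAW, Matrix.conjTranspose_mul, Matrix.conjTranspose_mul, Matrix.mul_assoc _ _ Wᴴ,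
          Matrix.mul_assoc _ _ Wᴴ, Matrix.mul_assoc A, hW', Matrix.mul_one]
        simp only [Matrix.mul_assoc]
      have e2 : R₀ᴴ * (Matrix.diagonal fun i => (l i : 𝕜)) =
          (Matrix.diagonal fun a => (l (Fin.castLE hr a) : 𝕜)) * R₀ᴴ := by
        ext a i
        rw [Matrix.mul_diagonal, Matrix.diagonal_mul]
        simp only [R₀, Matrix.conjTranspose_apply, Matrix.submatrix_apply, id, Matrix.one_apply]
        by_cases h : i = Fin.castLE hr a <;> simp [h]
      have e3 : Vᴴ * (1 - V * Vᴴ) = 0 := by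
        rw [Matrix.mul_sub, ← Matrix.mul_assoc, hV, Matrix.one_mul, Matrix.mul_one, sub_self]
      rw [hUX, Matrix.conjTranspose_mul, Matrix.conjTranspose_mul, Matrix.mul_assoc Xᴴ, e1, e2,
        Matrix.mul_assoc _ R₀ᴴ, ← Matrix.conjTranspose_mul W R₀, Matrix.mul_assoc,
        Matrix.mul_assoc _ Vᴴ, e3]
      simp
    rw [Matrix.mul_sub, Matrix.mul_one, sub_eq_zero] at h2
    rw [← h1, Matrix.mul_assoc U, Matrix.mul_assoc U, ← h2]
  -- V' spans the row space of B, so projecting it away gives ‖A - B‖ ≥ ‖A(1 - V'V'ᴴ)‖. It remains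
  -- to see that V' captures no more energy of A than V.
  · obtain ⟨V', -, hV', hBV', -⟩ := exists_isometry_range Bᴴ
    have hq : (Bᴴ.rank : ℝ) ≤ r := by
      rw [Matrix.rank_conjTranspose]
      exact_mod_cast hB
    have hV'proj := IsOrthProj.of_isometry hV'
    let R := Wᴴ * V'
    have hWR : W * R = V' := by rw [← Matrix.mul_assoc, hW', Matrix.one_mul]
    have hR : Rᴴ * R = 1 := by
      rw [Matrix.conjTranspose_mul, Matrix.conjTranspose_conjTranspose, Matrix.mul_assoc, hWR, hV']
    have hBP : B * (1 - V' * V'ᴴ) = 0 := by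
      have := congrArg Matrix.conjTranspose hBV'
      rw [Matrix.conjTranspose_mul, hV'proj.hermitian, Matrix.conjTranspose_conjTranspose] at this
      rw [Matrix.mul_sub, this, Matrix.mul_one, sub_self]
    have hle : ∑ i, l i * ∑ a, ‖R i a‖ ^ 2 ≤ ∑ i, l i * ∑ a, ‖R₀ i a‖ ^ 2 := by
      -- A threshold t separates the r largest weights l from the rest; it is 0 if nothing is left
      -- over. Moving mass at most 1 per index and at most r in total to the leading indices then
      -- changes the sum by at least t(r - rank B) ≥ 0.
      obtain ⟨t, ht0, ht1, ht2⟩ : ∃ t : ℝ, 0 ≤ t ∧ (∀ i : Fin n, (i : ℕ) < r → t ≤ l i) ∧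
          ∀ i : Fin n, r ≤ (i : ℕ) → l i ≤ t := by
        by_cases h : r < n
        · exact ⟨l ⟨r, h⟩, hl0 _, fun i hi => hl (Fin.le_def.2 hi.le), fun i hi => hl (Fin.le_def.2 hi)⟩
        · exact ⟨0, le_rfl, fun i _ => hl0 i, fun i hi => absurd i.2 (by omega)⟩
      have hterm : ∀ i, t * (∑ a, ‖R₀ i a‖ ^ 2 - ∑ a, ‖R i a‖ ^ 2) ≤
          l i * ∑ a, ‖R₀ i a‖ ^ 2 - l i * ∑ a, ‖R i a‖ ^ 2 := fun i => by
        have hR0 : R₀ i = fun a => if i = Fin.castLE hr a then 1 else 0 := by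
          ext a
          simp [R₀, Matrix.one_apply]
        rw [← mul_sub]
        by_cases hi : (i : ℕ) < r
        · have : ∑ a, ‖R₀ i a‖ ^ 2 = 1 := by
            rw [Finset.sum_eq_single ⟨i, hi⟩]
            · simp [hR0]
            · intro a _ ha
              have : i ≠ Fin.castLE hr a := fun h => ha (Fin.ext (congrArg Fin.val h).symm)
              simp [hR0, this]
            · simp
          rw [this]
          exact mul_le_mul_of_nonneg_right (ht1 i hi) (sub_nonneg.2 (sum_row_sq_le_one hR i))
        · have : ∑ a, ‖R₀ i a‖ ^ 2 = 0 := Finset.sum_eq_zero fun a _ => by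
            have : i ≠ Fin.castLE hr a := fun h => hi (by rw [h]; exact a.2)
            simp [hR0, this]
          rw [this, zero_sub]
          have hw : 0 ≤ ∑ a, ‖R i a‖ ^ 2 := by positivity
          nlinarith [ht2 i (not_lt.1 hi)]
      have hsum := Finset.sum_le_sum fun i (_ : i ∈ Finset.univ) => hterm i
      rw [← Finset.mul_sum, Finset.sum_sub_distrib, Finset.sum_sub_distrib, sum_row_sq hR,
        sum_row_sq hR₀] at hsum
      nlinarith [mul_nonneg ht0 (sub_nonneg.2 hq)]
    rw [← norm_mul_sq_of_gram_diagonal hAW, ← norm_mul_sq_of_gram_diagonal hAW, Matrix.mul_assoc,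
      hWR, Matrix.mul_assoc, ← frobenius_norm_mul_isometry hV', ← frobenius_norm_mul_isometry hV,
      Matrix.mul_assoc, Matrix.mul_assoc A] at hle
    have h1 := hVproj.norm_sq_right A
    have h2 := hV'proj.norm_sq_right A
    have h3 := hV'proj.compl.norm_mul_le' (A - B)
    rw [Matrix.sub_mul, hBP, sub_zero] at h3
    refine le_trans ?_ h3
    exact (pow_le_pow_iff_left₀ (norm_nonneg _) (norm_nonneg _) two_ne_zero).1 (by linarith)

end EckartYoung

/-! ### Error of the range and corange projections -/

section RangeError

variable {𝕜 : Type*} [RCLike 𝕜] {m n k d r : ℕ}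

/-- The left side equals ‖A‖² - ‖Q*AP‖², and ‖SAT‖ ≤ ‖Q*AP‖ because Q and P capture the ranges of S
and T. Then ‖A‖² - ‖SAT‖² splits by Pythagoras. -/
theorem norm_sq_sub_compress_le {A : Matrix (Fin m) (Fin n) 𝕜} {Q : Matrix (Fin m) (Fin k) 𝕜}
    {P : Matrix (Fin n) (Fin k) 𝕜} (hQ : Qᴴ * Q = 1) (hP : Pᴴ * P = 1)
    {S : Matrix (Fin m) (Fin m) 𝕜} {T : Matrix (Fin n) (Fin n) 𝕜} (hS : IsOrthProj S)
    (hT : IsOrthProj T) (hQS : Q * Qᴴ * S = S) (hPT : P * Pᴴ * T = T) :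
    ‖A - Q * (Qᴴ * A * P) * Pᴴ‖ ^ 2 ≤ ‖(1 - S) * A‖ ^ 2 + ‖S * (A * (1 - T))‖ ^ 2 := by
  have h1 := norm_sq_compress_sub hQ hP 0 A
  simp only [Matrix.mul_zero, Matrix.zero_mul, zero_sub, norm_neg] at h1
  have h2 := hS.norm_sq_left A
  have h3 := hT.norm_sq_right (S * A)
  have hSQ : S * (Q * Qᴴ) = S := by
    simpa [Matrix.conjTranspose_mul, hS.hermitian] using congrArg Matrix.conjTranspose hQS
  have h4 : S * A * T = S * (Q * (Qᴴ * A * P) * Pᴴ) * T := by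
    calc S * A * T = S * (Q * Qᴴ) * A * (P * Pᴴ * T) := by rw [hSQ, hPT]
      _ = _ := by simp only [Matrix.mul_assoc]
  have h5 : ‖S * A * T‖ ≤ ‖Qᴴ * A * P‖ := by
    rw [h4, ← frobenius_norm_isometry_mul hQ, ← frobenius_norm_mul_isometry hP]
    exact (hT.norm_mul_le' _).trans (hS.norm_mul_le _)
  have h6 := pow_le_pow_left₀ (norm_nonneg _) h5 2
  rw [Matrix.mul_assoc S A (1 - T)] at h3
  linarith

/-- Averaging the projection error over a reflection that commutes with `A`. -/
theorem norm_sq_reflection_average_le {A : Matrix (Fin m) (Fin n) 𝕜} {U : Matrix (Fin m) (Fin m) 𝕜}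
    {V : Matrix (Fin n) (Fin n) 𝕜} (hU : IsOrthProj U) (hV : IsOrthProj V) (hUV : U * A = A * V)
    {S S' : Matrix (Fin m) (Fin m) 𝕜} {T : Matrix (Fin n) (Fin n) 𝕜} (hS : IsOrthProj S)
    (hT : IsOrthProj T) (hS' : S' = (1 - (2 : 𝕜) • U) * S * (1 - (2 : 𝕜) • U)) :
    (‖(1 - S) * A‖ ^ 2 + ‖S * (A * T)‖ ^ 2) + (‖(1 - S') * A‖ ^ 2 + ‖S' * (A * T)‖ ^ 2) ≤
      2 * (‖(1 - S) * (A * V)‖ ^ 2 + (‖T * (Aᴴ * U)‖ ^ 2 + ‖A * (1 - V)‖ ^ 2)) := by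
  set F : Matrix (Fin m) (Fin m) 𝕜 := 1 - (2 : 𝕜) • U with hF
  have hFF : F * F = 1 := hU.reflection_mul_self
  have hFH : Fᴴ = F := hU.reflection_hermitian
  have hFiso : Fᴴ * F = 1 := by rw [hFH, hFF]
  clear_value F
  have hRiso : (1 - (2 : 𝕜) • V)ᴴ * (1 - (2 : 𝕜) • V) = 1 := by
    rw [hV.reflection_hermitian, hV.reflection_mul_self]
  have hFA : F * A = A * (1 - (2 : 𝕜) • V) := by
    rw [hF, Matrix.sub_mul, Matrix.mul_sub, Matrix.smul_mul, Matrix.mul_smul, hUV, Matrix.one_mul,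
      Matrix.mul_one]
  have h1 : ‖(1 - S') * A‖ = ‖(1 - S) * A‖ := by
    have : (1 - S') * A = F * ((1 - S) * A * (1 - (2 : 𝕜) • V)ᴴ) := by
      rw [hV.reflection_hermitian, Matrix.mul_assoc (1 - S), ← hFA, hS', Matrix.sub_mul, Matrix.one_mul,
        Matrix.sub_mul, Matrix.one_mul, Matrix.mul_sub, ← Matrix.mul_assoc F F, hFF, Matrix.one_mul]
      simp only [Matrix.mul_assoc]
    rw [this, frobenius_norm_isometry_mul hFiso, frobenius_norm_mul_isometry hRiso]
  have hsplit : U * (A * T) + (1 - U) * (A * T) = A * T := by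
    rw [← Matrix.add_mul, add_sub_cancel, Matrix.one_mul]
  have h2 : ‖S' * (A * T)‖ = ‖S * ((1 - U) * (A * T)) - S * (U * (A * T))‖ := by
    have : S' * (A * T) = F * (S * ((1 - U) * (A * T)) - S * (U * (A * T))) := by
      rw [hS', ← Matrix.mul_sub, ← Matrix.sub_mul, Matrix.mul_assoc, Matrix.mul_assoc]
      congr 3
      rw [hF]
      module
    rw [this, frobenius_norm_isometry_mul hFiso]
  have h3 : ‖S * (A * T)‖ = ‖S * ((1 - U) * (A * T)) + S * (U * (A * T))‖ := by
    rw [← Matrix.mul_add, add_comm, hsplit]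
  have h4 := frobenius_parallelogram (S * ((1 - U) * (A * T))) (S * (U * (A * T)))
  have hUA : (1 - U) * A = A * (1 - V) := by
    rw [Matrix.sub_mul, Matrix.mul_sub, hUV, Matrix.one_mul, Matrix.mul_one]
  have h5 : ‖S * (U * (A * T))‖ ≤ ‖T * (Aᴴ * U)‖ := by
    refine (hS.norm_mul_le _).trans (le_of_eq ?_)
    rw [← Matrix.frobenius_norm_conjTranspose]
    simp only [Matrix.conjTranspose_mul, hT.hermitian, hU.hermitian, Matrix.mul_assoc]
  have h6 : ‖S * ((1 - U) * (A * T))‖ ≤ ‖S * (A * (1 - V))‖ := by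
    rw [← Matrix.mul_assoc (1 - U), hUA, ← Matrix.mul_assoc]
    exact hT.norm_mul_le' _
  have h7 := hV.norm_sq_right ((1 - S) * A)
  rw [Matrix.mul_assoc _ A, Matrix.mul_assoc _ A] at h7
  -- The gain from averaging: the tail energies seen by S and by 1 - S recombine to a single ‖A(1 -
  -- V)‖².
  have h8 := hS.norm_sq_left (A * (1 - V))
  have h9 := pow_le_pow_left₀ (norm_nonneg _) h5 2
  have h10 := pow_le_pow_left₀ (norm_nonneg _) h6 2
  rw [h1, h2, h3]
  linarith

/-- Reflecting a matrix reflects the projection onto its column space. -/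
theorem mul_pinv_reflection {F : Matrix (Fin m) (Fin m) 𝕜} (hFF : F * F = 1) (hFH : Fᴴ = F)
    (Y : Matrix (Fin m) (Fin k) 𝕜) :
    F * Y * pinv (F * Y) = F * (Y * pinv Y) * F := by
  have hY := pinv_spec Y
  have hFY := pinv_spec (F * Y)
  have h1 : F * Y * pinv (F * Y) * (F * (Y * pinv Y) * F) = F * (Y * pinv Y) * F := by
    calc _ = (F * Y * pinv (F * Y) * (F * Y)) * pinv Y * F := by simp only [Matrix.mul_assoc]
      _ = _ := by rw [hFY.mul_mul_self]; simp only [Matrix.mul_assoc]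
  have h2 : F * (Y * pinv Y) * F * (F * Y * pinv (F * Y)) = F * Y * pinv (F * Y) := by
    calc _ = F * (Y * pinv Y) * (F * F) * (Y * pinv (F * Y)) := by simp only [Matrix.mul_assoc]
      _ = F * (Y * pinv Y * Y) * pinv (F * Y) := by
        rw [hFF, Matrix.mul_one]; simp only [Matrix.mul_assoc]
      _ = _ := by rw [hY.mul_mul_self]
  have h3 : (F * (Y * pinv Y) * F)ᴴ = F * (Y * pinv Y) * F := by
    rw [Matrix.conjTranspose_mul, Matrix.conjTranspose_mul, hFH, hY.left_hermitian]
    simp only [Matrix.mul_assoc]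
  calc F * Y * pinv (F * Y) = (F * Y * pinv (F * Y))ᴴ := hFY.left_hermitian.symm
    _ = (F * (Y * pinv Y) * F * (F * Y * pinv (F * Y)))ᴴ := by rw [h2]
    _ = F * Y * pinv (F * Y) * (F * (Y * pinv Y) * F) := by
      rw [Matrix.conjTranspose_mul, hFY.left_hermitian, h3]
    _ = F * (Y * pinv Y) * F := h1

/-- The structural error bound of the randomized range finder. -/
theorem norm_compl_mul_le {A : Matrix (Fin m) (Fin n) 𝕜} {Ω : Matrix (Fin k) (Fin n) 𝕜}
    {V : Matrix (Fin n) (Fin r) 𝕜} (hV : Vᴴ * V = 1) (hΩ : IsUnit ((Ω * V)ᴴ * (Ω * V)).det)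
    {S : Matrix (Fin m) (Fin m) 𝕜} (hS : IsOrthProj S) (hSY : S * (A * Ωᴴ) = A * Ωᴴ) :
    ‖(1 - S) * (A * (V * Vᴴ))‖ ≤ ‖leftInv (Ω * V) * Ω * (A * (1 - V * Vᴴ))ᴴ‖ := by
  set L := leftInv (Ω * V)
  have hL : Vᴴ * (Ωᴴ * Lᴴ) = 1 := by
    have := congrArg Matrix.conjTranspose (leftInv_mul hΩ)
    simpa [Matrix.conjTranspose_mul, Matrix.mul_assoc] using this
  obtain ⟨Z, hZ⟩ : ∃ Z, Z = A * (1 - V * Vᴴ) := ⟨_, rfl⟩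
  obtain ⟨T, hT⟩ : ∃ T, T = 1 - S := ⟨_, rfl⟩
  have hTp : IsOrthProj T := hT ▸ hS.compl
  have h0 : T * (A * Ωᴴ) = 0 := by rw [hT, Matrix.sub_mul, hSY, Matrix.one_mul, sub_self]
  -- Inserting VᴴΩᴴLᴴ = 1 writes the leading part of A through the sketch AΩᴴ, which 1 - S kills,
  -- and the tail Z, which is all that remains.
  have h1 : A * (V * Vᴴ) = (A * Ωᴴ - Z * Ωᴴ) * Lᴴ * Vᴴ := by
    have : A * Ωᴴ - Z * Ωᴴ = A * (V * Vᴴ) * Ωᴴ := by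
      rw [hZ, Matrix.mul_sub, Matrix.sub_mul, Matrix.mul_one, sub_sub_cancel]
    rw [this]
    calc A * (V * Vᴴ) = A * V * (Vᴴ * (Ωᴴ * Lᴴ)) * Vᴴ := by
          rw [hL, Matrix.mul_one, Matrix.mul_assoc]
      _ = _ := by simp only [Matrix.mul_assoc]
  have h2 : T * (A * (V * Vᴴ)) = -(T * (Z * Ωᴴ * Lᴴ) * Vᴴ) := by
    rw [h1, ← Matrix.mul_assoc, ← Matrix.mul_assoc, Matrix.mul_sub, h0, zero_sub, Matrix.neg_mul,
      Matrix.neg_mul, Matrix.mul_assoc T]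
  rw [← hT, ← hZ, h2, norm_neg, frobenius_norm_mul_isometry hV]
  refine (hTp.norm_mul_le _).trans (le_of_eq ?_)
  rw [← Matrix.frobenius_norm_conjTranspose]
  simp only [Matrix.conjTranspose_mul, Matrix.conjTranspose_conjTranspose, Matrix.mul_assoc]

variable [MeasurableSpace 𝕜] [BorelSpace 𝕜]

theorem lintegral_norm_compl_mul_sq_le (A : Matrix (Fin m) (Fin n) 𝕜) (hr : r + fieldAlpha 𝕜 < k)
    {V : Matrix (Fin n) (Fin r) 𝕜} (hV : Vᴴ * V = 1) :
    ∫⁻ Ω : Matrix (Fin k) (Fin n) 𝕜,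
        ENNReal.ofReal (‖(1 - A * Ωᴴ * pinv (A * Ωᴴ)) * (A * (V * Vᴴ))‖ ^ 2)
          ∂(gaussianMatrix 𝕜 k n) ≤
      ENNReal.ofReal (r / (k - r - fieldAlpha 𝕜) * ‖A * (1 - V * Vᴴ)‖ ^ 2) := by
  have hM : Vᴴ * (A * (1 - V * Vᴴ))ᴴ = 0 := by
    rw [← Matrix.conjTranspose_mul, Matrix.mul_assoc, Matrix.sub_mul, Matrix.mul_assoc, hV]
    simp
  have h := lintegral_norm_leftInv_mul_mul_sq_le hr hV hM
  rw [Matrix.frobenius_norm_conjTranspose] at h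
  refine (lintegral_mono_ae ?_).trans h
  filter_upwards [ae_isUnit_det_mul_isometry (by omega) hV] with Ω hΩ
  exact ENNReal.ofReal_le_ofReal (pow_le_pow_left₀ (norm_nonneg _) (norm_compl_mul_le hV hΩ
    (isOrthProj_mul_pinv _) (pinv_spec _).mul_mul_self) 2)

/-- The expected error of the two-sided projection onto the range and corange sketches. -/
theorem lintegral_norm_sub_compress_sq_le (A : Matrix (Fin m) (Fin n) 𝕜) (hr : r + fieldAlpha 𝕜 < k)
    (hrn : r ≤ n)
    {qrP : Matrix (Fin n) (Fin k) 𝕜 → Matrix (Fin n) (Fin k) 𝕜} (hqrP : IsThinQR qrP)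
    {qrQ : Matrix (Fin m) (Fin k) 𝕜 → Matrix (Fin m) (Fin k) 𝕜} (hqrQ : IsThinQR qrQ) :
    ∫⁻ z : Matrix (Fin k) (Fin m) 𝕜 × Matrix (Fin k) (Fin n) 𝕜,
        ENNReal.ofReal (‖A - qrQ (A * z.2ᴴ) * ((qrQ (A * z.2ᴴ))ᴴ * A * qrP (z.1 * A)ᴴ) *
          (qrP (z.1 * A)ᴴ)ᴴ‖ ^ 2) ∂((gaussianMatrix 𝕜 k m).prod (gaussianMatrix 𝕜 k n)) ≤
      ENNReal.ofReal ((k + r - fieldAlpha 𝕜) / (k - r - fieldAlpha 𝕜) *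
        tailEnergy (r + 1) A ^ 2) := by
  obtain ⟨d, U, V, hd, hU, hV, hUV, hbest⟩ := exists_singular_projections A hrn
  have hUp := IsOrthProj.of_isometry hU
  have hVp := IsOrthProj.of_isometry hV
  have hr' : (r : ℝ) + fieldAlpha 𝕜 < k := by exact_mod_cast hr
  have hd' : (d : ℝ) ≤ r := by exact_mod_cast hd
  set τ := ‖A * (1 - V * Vᴴ)‖ ^ 2 with hτ
  have hτ0 : 0 ≤ τ := sq_nonneg _
  have hτle : τ ≤ tailEnergy (r + 1) A ^ 2 :=
    pow_le_pow_left₀ (norm_nonneg _) (le_tailEnergy hbest) 2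
  have hqr : ∀ {N : ℕ} {qr : Matrix (Fin N) (Fin k) 𝕜 → Matrix (Fin N) (Fin k) 𝕜} (_ : IsThinQR qr)
      (M : Matrix (Fin N) (Fin k) 𝕜), qr M * (qr M)ᴴ * (M * pinv M) = M * pinv M := by
    intro N qr h M
    obtain ⟨R, -, hR⟩ := h.factor M
    have : qr M * (qr M)ᴴ * M = M :=
      calc qr M * (qr M)ᴴ * M = qr M * (qr M)ᴴ * (qr M * R) := congrArg _ hR
        _ = qr M * ((qr M)ᴴ * qr M) * R := by simp only [Matrix.mul_assoc]
        _ = M := by rw [h.orthonormal, Matrix.mul_one]; exact hR.symm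
    rw [← Matrix.mul_assoc, this]
  have inner : ∀ Υ : Matrix (Fin k) (Fin m) 𝕜,
      ∫⁻ Ω : Matrix (Fin k) (Fin n) 𝕜,
        ENNReal.ofReal (‖A - qrQ (A * Ωᴴ) * ((qrQ (A * Ωᴴ))ᴴ * A * qrP (Υ * A)ᴴ) *
          (qrP (Υ * A)ᴴ)ᴴ‖ ^ 2) ∂(gaussianMatrix 𝕜 k n) ≤
      ENNReal.ofReal (r / (k - r - fieldAlpha 𝕜) * τ) +
        (ENNReal.ofReal (‖(1 - Aᴴ * Υᴴ * pinv (Aᴴ * Υᴴ)) * (Aᴴ * (U * Uᴴ))‖ ^ 2) +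
          ENNReal.ofReal τ) := by
    intro Υ
    set T := Aᴴ * Υᴴ * pinv (Aᴴ * Υᴴ) with hT
    have hTp : IsOrthProj T := isOrthProj_mul_pinv _
    set c := ENNReal.ofReal (‖(1 - T) * (Aᴴ * (U * Uᴴ))‖ ^ 2) + ENNReal.ofReal τ with hc
    -- The projection onto the range of the sketch replaces QQ*. It reflects along with Ω, whereas
    -- an arbitrary QR routine need not, and Q has arbitrary extra columns if the sketch is rank
    -- deficient.
    let S : Matrix (Fin k) (Fin n) 𝕜 → Matrix (Fin m) (Fin m) 𝕜 := fun Ω =>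
      A * Ωᴴ * pinv (A * Ωᴴ)
    have hSp : ∀ Ω, IsOrthProj (S Ω) := fun Ω => isOrthProj_mul_pinv _
    have hSrefl : ∀ Ω : Matrix (Fin k) (Fin n) 𝕜, S (Ω * (1 - (2 : 𝕜) • (V * Vᴴ))) =
        (1 - (2 : 𝕜) • (U * Uᴴ)) * S Ω * (1 - (2 : 𝕜) • (U * Uᴴ)) := fun Ω => by
      have : A * (Ω * (1 - (2 : 𝕜) • (V * Vᴴ)))ᴴ = (1 - (2 : 𝕜) • (U * Uᴴ)) * (A * Ωᴴ) := by
        rw [Matrix.conjTranspose_mul, hVp.reflection_hermitian, ← Matrix.mul_assoc, ← Matrix.mul_assoc,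
          Matrix.sub_mul, Matrix.mul_sub, Matrix.smul_mul, Matrix.mul_smul, hUV, Matrix.one_mul,
          Matrix.mul_one]
      simp only [S, this]
      exact mul_pinv_reflection hUp.reflection_mul_self hUp.reflection_hermitian _
    calc _ ≤ ∫⁻ Ω : Matrix (Fin k) (Fin n) 𝕜, ENNReal.ofReal (‖(1 - S Ω) * A‖ ^ 2 +
            ‖S Ω * (A * (1 - T))‖ ^ 2) ∂(gaussianMatrix 𝕜 k n) := by
          refine lintegral_mono fun Ω => ENNReal.ofReal_le_ofReal ?_
          refine norm_sq_sub_compress_le (hqrQ.orthonormal _) (hqrP.orthonormal _) (hSp Ω) hTp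
            (hqr hqrQ _) ?_
          rw [hT, ← Matrix.conjTranspose_mul]
          exact hqr hqrP _
      _ ≤ ∫⁻ Ω : Matrix (Fin k) (Fin n) 𝕜,
            (ENNReal.ofReal (‖(1 - S Ω) * (A * (V * Vᴴ))‖ ^ 2) + c) ∂(gaussianMatrix 𝕜 k n) := by
          refine lintegral_le_of_average (measurePreserving_mul_reflection hVp)
            (involutive_mul_reflection hVp) fun Ω => ?_
          rw [hc, ← ENNReal.ofReal_add (by positivity) (by positivity),
            ← ENNReal.ofReal_add (by positivity) (by positivity),
            ← ENNReal.ofReal_add (by positivity) (by positivity), ← ENNReal.ofReal_ofNat 2,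
            ← ENNReal.ofReal_mul zero_le_two]
          exact ENNReal.ofReal_le_ofReal (norm_sq_reflection_average_le hUp hVp hUV (hSp Ω) hTp.compl
            (hSrefl Ω))
      _ ≤ _ := by
          rw [lintegral_add_right _ measurable_const, lintegral_const, measure_univ, mul_one]
          exact add_le_add_left (lintegral_norm_compl_mul_sq_le A hr hV) _
  refine (lintegral_prod_le _).trans ((lintegral_mono inner).trans ?_)
  rw [lintegral_add_left measurable_const, lintegral_add_right _ measurable_const, lintegral_const,
    lintegral_const, measure_univ, mul_one, mul_one]
  have hdk : d + fieldAlpha 𝕜 < k := by omega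
  -- For Aᴴ the left basis U plays the role of V with the same tail, since UUᴴA = AVVᴴ. It may have
  -- d < r columns, which only helps because x/(k - x - α) increases with x.
  have hX := lintegral_norm_compl_mul_sq_le Aᴴ hdk hU
  have hτ' : ‖Aᴴ * (1 - U * Uᴴ)‖ ^ 2 = τ := by
    have hc : (1 - U * Uᴴ) * A = A * (1 - V * Vᴴ) := by
      rw [Matrix.sub_mul, Matrix.mul_sub, hUV, Matrix.one_mul, Matrix.mul_one]
    rw [hτ, ← hc, ← Matrix.frobenius_norm_conjTranspose ((1 - U * Uᴴ) * A), Matrix.conjTranspose_mul,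
      hUp.compl.hermitian]
  rw [hτ'] at hX
  refine (add_le_add_right (add_le_add_left hX _) _).trans ?_
  have h1 : (0 : ℝ) ≤ d / (k - d - fieldAlpha 𝕜) := div_nonneg (by positivity) (by linarith)
  have h2 : (0 : ℝ) ≤ r / (k - r - fieldAlpha 𝕜) := div_nonneg (by positivity) (by linarith)
  rw [← ENNReal.ofReal_add (by positivity) (by positivity),
    ← ENNReal.ofReal_add (by positivity) (by positivity)]
  refine ENNReal.ofReal_le_ofReal ?_
  have h3 : (d : ℝ) / (k - d - fieldAlpha 𝕜) ≤ r / (k - r - fieldAlpha 𝕜) :=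
    div_le_div₀ (by positivity) hd' (by linarith) (by linarith)
  have h4 : ((k : ℝ) + r - fieldAlpha 𝕜) / (k - r - fieldAlpha 𝕜) =
      1 + 2 * (r / (k - r - fieldAlpha 𝕜)) := by
    have : (k : ℝ) - r - fieldAlpha 𝕜 ≠ 0 := by linarith
    field_simp
    ring
  rw [h4]
  nlinarith [mul_le_mul_of_nonneg_right h3 hτ0, mul_nonneg h2 (sub_nonneg.2 hτle)]

end RangeError

/-! ### Second-moment bound and passage to the first moment -/

section MainBound

variable {𝕜 : Type*} [RCLike 𝕜] [MeasurableSpace 𝕜] [BorelSpace 𝕜] {m n k s : ℕ}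

/-- The squared error of the initial approximation as a measurable function of the test
matrices. -/
noncomputable def sketchErrorSq (A : Matrix (Fin m) (Fin n) 𝕜)
    (qrP : Matrix (Fin n) (Fin k) 𝕜 → Matrix (Fin n) (Fin k) 𝕜)
    (qrQ : Matrix (Fin m) (Fin k) 𝕜 → Matrix (Fin m) (Fin k) 𝕜)
    (z : Matrix (Fin k) (Fin m) 𝕜 × Matrix (Fin k) (Fin n) 𝕜 ×
      Matrix (Fin s) (Fin m) 𝕜 × Matrix (Fin s) (Fin n) 𝕜) : ENNReal :=
  ENNReal.ofReal (‖A - qrQ (A * z.2.1ᴴ) * leftInvCore A z.2.2.1 z.2.2.2 (qrQ (A * z.2.1ᴴ))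
    (qrP (z.1 * A)ᴴ) * (qrP (z.1 * A)ᴴ)ᴴ‖ ^ 2)

variable {A : Matrix (Fin m) (Fin n) 𝕜}
  {qrP : Matrix (Fin n) (Fin k) 𝕜 → Matrix (Fin n) (Fin k) 𝕜}
  {qrQ : Matrix (Fin m) (Fin k) 𝕜 → Matrix (Fin m) (Fin k) 𝕜}

theorem measurable_sketchErrorSq (hqrP : IsThinQR qrP) (hqrQ : IsThinQR qrQ) :
    Measurable (sketchErrorSq (s := s) A qrP qrQ) := by
  have hP : Measurable fun z : Matrix (Fin k) (Fin m) 𝕜 × Matrix (Fin k) (Fin n) 𝕜 ×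
      Matrix (Fin s) (Fin m) 𝕜 × Matrix (Fin s) (Fin n) 𝕜 => qrP (z.1 * A)ᴴ :=
    hqrP.measurable.comp (measurable_fst.matrix_mul measurable_const).matrix_conjTranspose
  have hQ : Measurable fun z : Matrix (Fin k) (Fin m) 𝕜 × Matrix (Fin k) (Fin n) 𝕜 ×
      Matrix (Fin s) (Fin m) 𝕜 × Matrix (Fin s) (Fin n) 𝕜 => qrQ (A * z.2.1ᴴ) :=
    hqrQ.measurable.comp (measurable_const.matrix_mul
      (measurable_fst.comp measurable_snd).matrix_conjTranspose)
  have hΦ : Measurable fun z : Matrix (Fin k) (Fin m) 𝕜 × Matrix (Fin k) (Fin n) 𝕜 ×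
      Matrix (Fin s) (Fin m) 𝕜 × Matrix (Fin s) (Fin n) 𝕜 => z.2.2.1 :=
    measurable_fst.comp (measurable_snd.comp measurable_snd)
  have hΨ : Measurable fun z : Matrix (Fin k) (Fin m) 𝕜 × Matrix (Fin k) (Fin n) 𝕜 ×
      Matrix (Fin s) (Fin m) 𝕜 × Matrix (Fin s) (Fin n) 𝕜 => z.2.2.2 :=
    measurable_snd.comp (measurable_snd.comp measurable_snd)
  have hcore := ((measurable_leftInv.comp (hΦ.matrix_mul hQ)).matrix_mul
    ((hΦ.matrix_mul (measurable_const (a := A))).matrix_mul hΨ.matrix_conjTranspose)).matrix_mul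
      (measurable_leftInv.comp (hΨ.matrix_mul hP)).matrix_conjTranspose
  exact ((measurable_frobenius_norm.comp ((measurable_const (a := A)).matrix_sub
    ((hQ.matrix_mul hcore).matrix_mul hP.matrix_conjTranspose))).pow_const 2).ennreal_ofReal

-- The columns are orthonormal even for the zero matrix. This supplies ϱ < k ≤ n for the singular
-- projections.
omit [BorelSpace 𝕜] in
theorem IsThinQR.le_height {N : ℕ} {qr : Matrix (Fin N) (Fin k) 𝕜 → Matrix (Fin N) (Fin k) 𝕜}
    (h : IsThinQR qr) : k ≤ N := by
  have h1 := h.orthonormal 0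
  have h2 : ((qr 0)ᴴ * qr 0).rank = k := by
    rw [h1, Matrix.rank_one, Fintype.card_fin]
  exact h2 ▸ (Matrix.rank_mul_le_right _ _).trans (Matrix.rank_le_height _)

theorem lintegral_sketchErrorSq_le (hk : fieldAlpha 𝕜 < k) (hs : 2 * k + fieldAlpha 𝕜 ≤ s)
    (hqrP : IsThinQR qrP) (hqrQ : IsThinQR qrQ) :
    ∫⁻ z, sketchErrorSq A qrP qrQ z ∂((gaussianMatrix 𝕜 k m).prod ((gaussianMatrix 𝕜 k n).prod
        ((gaussianMatrix 𝕜 s m).prod (gaussianMatrix 𝕜 s n)))) ≤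
      ENNReal.ofReal (initialErrorBound k s A) := by
  have hs' : 2 * (k : ℝ) + fieldAlpha 𝕜 ≤ s := by exact_mod_cast hs
  have hk' : (fieldAlpha 𝕜 : ℝ) < k := by exact_mod_cast hk
  have hα : (0 : ℝ) ≤ fieldAlpha 𝕜 := Nat.cast_nonneg _
  have hc : (0 : ℝ) ≤ (s - fieldAlpha 𝕜) / (s - k - fieldAlpha 𝕜) :=
    div_nonneg (by linarith) (by linarith)
  have : Nonempty (Fin (k - fieldAlpha 𝕜)) := ⟨⟨0, by omega⟩⟩
  obtain ⟨r, hr⟩ := exists_eq_ciInf_of_finite (f := fun ϱ : Fin (k - fieldAlpha 𝕜) =>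
    ((k : ℝ) + (ϱ : ℕ) - fieldAlpha 𝕜) / ((k : ℝ) - (ϱ : ℕ) - fieldAlpha 𝕜) *
        tailEnergy ((ϱ : ℕ) + 1) A ^ 2)
  have hrk : (r : ℕ) + fieldAlpha 𝕜 < k := by have := r.2; omega
  rw [initialErrorBound, ← hr, ENNReal.ofReal_mul hc]
  refine le_trans ?_ (mul_le_mul_right (lintegral_norm_sub_compress_sq_le A hrk
    (by have := hqrP.le_height; omega) hqrP hqrQ) _)
  refine (lintegral_prod_le _).trans ?_
  have hm : Measurable fun z : Matrix (Fin k) (Fin m) 𝕜 × Matrix (Fin k) (Fin n) 𝕜 =>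
      ENNReal.ofReal (‖A - qrQ (A * z.2ᴴ) * ((qrQ (A * z.2ᴴ))ᴴ * A * qrP (z.1 * A)ᴴ) *
        (qrP (z.1 * A)ᴴ)ᴴ‖ ^ 2) := by
    have hP : Measurable fun z : Matrix (Fin k) (Fin m) 𝕜 × Matrix (Fin k) (Fin n) 𝕜 =>
        qrP (z.1 * A)ᴴ :=
      hqrP.measurable.comp (measurable_fst.matrix_mul measurable_const).matrix_conjTranspose
    have hQ : Measurable fun z : Matrix (Fin k) (Fin m) 𝕜 × Matrix (Fin k) (Fin n) 𝕜 =>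
        qrQ (A * z.2ᴴ) :=
      hqrQ.measurable.comp (measurable_const.matrix_mul measurable_snd.matrix_conjTranspose)
    exact ((measurable_frobenius_norm.comp ((measurable_const (a := A)).matrix_sub
      ((hQ.matrix_mul ((hQ.matrix_conjTranspose.matrix_mul measurable_const).matrix_mul
        hP)).matrix_mul hP.matrix_conjTranspose))).pow_const 2).ennreal_ofReal
  -- On the larger side the joint integral must equal the iterated one, hence `hm`; on the smaller
  -- side an inequality suffices.
  rw [← lintegral_const_mul' _ _ ENNReal.ofReal_ne_top, lintegral_prod _ (hm.const_mul _).aemeasurable]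
  refine lintegral_mono fun Υ => (lintegral_prod_le _).trans (lintegral_mono fun Ω => ?_)
  refine (lintegral_norm_sub_leftInvCore_sq_le A (by omega) hs (hqrQ.orthonormal (A * Ωᴴ))
    (hqrP.orthonormal (Υ * A)ᴴ)).trans (le_of_eq ?_)
  rw [ENNReal.ofReal_mul hc]

/-- Q and P depend only on Ω and Υ. With these frozen, ΦQ and ΨP are Gaussian with s ≥ k rows, hence
almost surely of full column rank. -/
theorem ae_isUnit_det_sketches (hks : k ≤ s) (hqrP : IsThinQR qrP) (hqrQ : IsThinQR qrQ) :
    ∀ᵐ z ∂((gaussianMatrix 𝕜 k m).prod ((gaussianMatrix 𝕜 k n).prod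
        ((gaussianMatrix 𝕜 s m).prod (gaussianMatrix 𝕜 s n)))),
      IsUnit ((z.2.2.1 * qrQ (A * z.2.1ᴴ))ᴴ * (z.2.2.1 * qrQ (A * z.2.1ᴴ))).det ∧
      IsUnit ((z.2.2.2 * qrP (z.1 * A)ᴴ)ᴴ * (z.2.2.2 * qrP (z.1 * A)ᴴ)).det := by
  have hP : Measurable fun z : Matrix (Fin k) (Fin m) 𝕜 × Matrix (Fin k) (Fin n) 𝕜 ×
      Matrix (Fin s) (Fin m) 𝕜 × Matrix (Fin s) (Fin n) 𝕜 => z.2.2.2 * qrP (z.1 * A)ᴴ :=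
    (measurable_snd.comp (measurable_snd.comp measurable_snd)).matrix_mul
      (hqrP.measurable.comp (measurable_fst.matrix_mul measurable_const).matrix_conjTranspose)
  have hQ : Measurable fun z : Matrix (Fin k) (Fin m) 𝕜 × Matrix (Fin k) (Fin n) 𝕜 ×
      Matrix (Fin s) (Fin m) 𝕜 × Matrix (Fin s) (Fin n) 𝕜 => z.2.2.1 * qrQ (A * z.2.1ᴴ) :=
    (measurable_fst.comp (measurable_snd.comp measurable_snd)).matrix_mul
      (hqrQ.measurable.comp (measurable_const.matrix_mul
        (measurable_fst.comp measurable_snd).matrix_conjTranspose))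
  have hset := (hQ measurableSet_isUnit_det).inter (hP measurableSet_isUnit_det)
  refine (Measure.ae_prod_mem_iff_ae_ae_mem hset).2 (.of_forall fun Υ => ?_)
  refine (Measure.ae_prod_mem_iff_ae_ae_mem (measurable_prodMk_left hset)).2
    (.of_forall fun Ω => ?_)
  exact (Measure.quasiMeasurePreserving_fst.ae
    (ae_isUnit_det_mul_isometry hks (hqrQ.orthonormal (A * Ωᴴ)))).and
    (Measure.quasiMeasurePreserving_snd.ae
      (ae_isUnit_det_mul_isometry hks (hqrP.orthonormal (Υ * A)ᴴ)))

/-- A second-moment bound on the error gives a first-moment bound after truncation. -/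
theorem integral_le_of_lintegral_sq_le {S : Type*} [MeasurableSpace S] {μ : Measure S}
    [IsProbabilityMeasure μ] {f g : S → ℝ} {t b : ℝ} (hf : AEMeasurable f μ) (hf0 : ∀ x, 0 ≤ f x)
    (ht : 0 ≤ t) (hfg : ∀ᵐ x ∂μ, f x ≤ t + 2 * g x)
    (hg : ∫⁻ x, ENNReal.ofReal (g x ^ 2) ∂μ ≤ ENNReal.ofReal b) :
    Integrable f μ ∧ ∫ x, f x ∂μ ≤ t + 2 * √b := by
  -- Uses 2g ≤ c + g²/c in place of Cauchy–Schwarz, so g need not be measurable. The strict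
  -- inequality keeps c positive when b = 0; c is sent to √b at the end.
  have key : ∀ c : ℝ, √b < c → ∫⁻ x, ENNReal.ofReal (f x) ∂μ ≤ ENNReal.ofReal (t + 2 * c) := by
    intro c hc
    have hc0 : 0 < c := (Real.sqrt_nonneg b).trans_lt hc
    have hbc : b ≤ c ^ 2 := (Real.sqrt_le_iff.1 hc.le).2
    have h1 : ∀ᵐ x ∂μ, ENNReal.ofReal (f x) ≤
        ENNReal.ofReal (t + c) + ENNReal.ofReal c⁻¹ * ENNReal.ofReal (g x ^ 2) := by
      filter_upwards [hfg] with x hx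
      rw [← ENNReal.ofReal_mul (by positivity), ← ENNReal.ofReal_add (by positivity) (by positivity)]
      refine ENNReal.ofReal_le_ofReal (hx.trans ?_)
      have h2 : c⁻¹ * (g x - c) ^ 2 = c⁻¹ * g x ^ 2 - 2 * g x + c := by
        field_simp
        ring
      have h3 : 0 ≤ c⁻¹ * (g x - c) ^ 2 := by positivity
      linarith
    refine (lintegral_mono_ae h1).trans ?_
    rw [lintegral_add_left measurable_const, lintegral_const, measure_univ, mul_one,
      lintegral_const_mul' _ _ ENNReal.ofReal_ne_top]
    refine (add_le_add_right (mul_le_mul_right (hg.trans (ENNReal.ofReal_le_ofReal hbc)) _) _).trans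
      (le_of_eq ?_)
    rw [← ENNReal.ofReal_mul (by positivity), ← ENNReal.ofReal_add (by positivity) (by positivity)]
    congr 1
    field_simp
    ring
  have hint : Integrable f μ := by
    refine ⟨hf.aestronglyMeasurable, ?_⟩
    rw [hasFiniteIntegral_iff_ofReal (.of_forall hf0)]
    exact (key (√b + 1) (by linarith)).trans_lt ENNReal.ofReal_lt_top
  refine ⟨hint, le_of_forall_pos_le_add fun ε hε => ?_⟩
  have h := key (√b + ε / 2) (by linarith)
  rw [← ofReal_integral_eq_lintegral_ofReal hint (.of_forall hf0), ENNReal.ofReal_le_ofReal_iff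
    (by positivity)] at h
  linarith

end MainBound

theorem corollary5p2 {𝕜 : Type*} [RCLike 𝕜] [MeasurableSpace 𝕜] [BorelSpace 𝕜]
    {m n k s : ℕ} (A : Matrix (Fin m) (Fin n) 𝕜)
    (hk : fieldAlpha 𝕜 < k) (hs : 2 * k + fieldAlpha 𝕜 ≤ s)
    -- independent Gaussian test matrices on a probability space
    {S : Type*} [MeasurableSpace S] (μ : Measure S) [IsProbabilityMeasure μ]
    (Υ : S → Matrix (Fin k) (Fin m) 𝕜) (Ω : S → Matrix (Fin k) (Fin n) 𝕜)
    (Φ : S → Matrix (Fin s) (Fin m) 𝕜) (Ψ : S → Matrix (Fin s) (Fin n) 𝕜)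
    (hlaw : HasLaw (fun x => (Υ x, Ω x, Φ x, Ψ x))
      ((gaussianMatrix 𝕜 k m).prod ((gaussianMatrix 𝕜 k n).prod
        ((gaussianMatrix 𝕜 s m).prod (gaussianMatrix 𝕜 s n)))) μ)
    -- the thin QR routines for `X*` and `Y`
    (qrP : Matrix (Fin n) (Fin k) 𝕜 → Matrix (Fin n) (Fin k) 𝕜) (hqrP : IsThinQR qrP)
    (qrQ : Matrix (Fin m) (Fin k) 𝕜 → Matrix (Fin m) (Fin k) 𝕜) (hqrQ : IsThinQR qrQ)
    -- the reconstruction from the sketch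
    (P : S → Matrix (Fin n) (Fin k) 𝕜) (hP : ∀ x, P x = qrP (corangeSketch (Υ x) A)ᴴ)
    (Q : S → Matrix (Fin m) (Fin k) 𝕜) (hQ : ∀ x, Q x = qrQ (rangeSketch A (Ω x)))
    (C : S → Matrix (Fin k) (Fin k) 𝕜)
    (hC : ∀ x, C x = coreApprox (Φ x) (Ψ x) (coreSketch (Φ x) A (Ψ x)) (Q x) (P x))
    (Ahat : S → Matrix (Fin m) (Fin n) 𝕜) (hAhat : ∀ x, Ahat x = initialApprox (Q x) (C x) (P x))
    (r : ℕ) :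
    -- the truncations of `Â` are the matrices `Q [C]_r P*`
    (∀ x B, IsBestRankApprox r (Ahat x) B ↔
      ∃ Cr, IsBestRankApprox r (C x) Cr ∧ B = Q x * Cr * (P x)ᴴ) ∧
    -- every (measurable) truncation of `Â` obeys the error bound
    ∀ T : S → Matrix (Fin m) (Fin n) 𝕜, AEMeasurable T μ →
      (∀ᵐ x ∂μ, IsBestRankApprox r (Ahat x) (T x)) →
      Integrable (fun x => ‖A - T x‖) μ ∧
      ∫ x, ‖A - T x‖ ∂μ ≤ tailEnergy (r + 1) A + 2 * √(initialErrorBound k s A) := by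
  have hQo : ∀ x, (Q x)ᴴ * Q x = 1 := fun x => by rw [hQ]; exact hqrQ.orthonormal _
  have hPo : ∀ x, (P x)ᴴ * P x = 1 := fun x => by rw [hP]; exact hqrP.orthonormal _
  refine ⟨fun x B => ?_, fun T hT hTbest => ?_⟩
  · rw [hAhat]
    exact isBestRankApprox_compress_iff (hQo x) (hPo x) r (C x) B
  have hT' : AEMeasurable (fun x => ‖A - T x‖) μ :=
    (measurable_frobenius_norm.comp
      ((measurable_const (a := A)).matrix_sub measurable_id)).comp_aemeasurable hT
  refine integral_le_of_lintegral_sq_le (g := fun x => ‖A - Ahat x‖) hT' (fun x => norm_nonneg _)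
    (Real.sqrt_nonneg _) ?_ ?_
  · filter_upwards [hTbest] with x hx
    exact norm_sub_isBestRankApprox_le hx
  · have hunit := ae_of_ae_map hlaw.aemeasurable
      (hlaw.map_eq.symm ▸ ae_isUnit_det_sketches (A := A) (by omega) hqrP hqrQ)
    -- Off a null set the pseudoinverses are given by the explicit, measurable left-inverse formula,
    -- so the integral can be moved to the product law of the test matrices.
    have heq : ∀ᵐ x ∂μ, ENNReal.ofReal (‖A - Ahat x‖ ^ 2) =
        sketchErrorSq A qrP qrQ (Υ x, Ω x, Φ x, Ψ x) := by
      filter_upwards [hunit] with x hx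
      have hQx : Q x = qrQ (A * (Ω x)ᴴ) := hQ x
      have hPx : P x = qrP (Υ x * A)ᴴ := hP x
      simp only [← hQx, ← hPx] at hx
      rw [hAhat, hC, sketchErrorSq, ← hQx, ← hPx, initialApprox, coreApprox, coreSketch,
        pinv_eq_of_isUnit_det hx.1, pinv_eq_of_isUnit_det hx.2]
      rfl
    rw [lintegral_congr_ae heq, hlaw.lintegral_comp
      (measurable_sketchErrorSq (A := A) (s := s) hqrP hqrQ).aemeasurable]
    exact lintegral_sketchErrorSq_le hk hs hqrP hqrQ
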